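/- **Theorem 3.2 (conditional CLT for network dependent arrays).** *Setting.* Let $(\Omega,\mathcal F,\mathbf P)$ be a probability space and, for each $n$, let $\mathcal C_n\subseteq\mathcal F$ be a $\sigma$-field, $G_n$ a random undirected graph on $N_n=\{1,\dots,n\}$ whose adjacency matrix is $\mathcal C_n$-measurable, and $(Y_{n,i})_{i\in N_n}$ real random variables. Let $d_n(i,j)\in\{0,1,\dots\}\cup\{\infty\}$ be the length of a shortest path from $i$ to $j$ in $G_n$ ($\infty$ if there is none), $d_n(A,B)=\min_{i\in A,\,j\in B}d_n(i,j)$, $N_n(i;s)=\{j:d_n(i,j)\le s\}$ and $N_n^\partial(i;s)=\{j:d_n(i,j)=s\}$; put $N_n(j;-1)=\varnothing$ and take the maximum over the empty set to be $0$. Define $$\delta_n^\partial(s;k)=\frac1n\sum_{i\in N_n}|N_n^\partial(i;s)|^k,\qquad \Delta_n(s,m;k)=\frac1n\sum_{i\in N_n}\max_{j\in N_n^\partial(i;s)}|N_n(i;m)\setminus N_n(j;s-1)|^k,$$ $$c_n(s,m;k)=\inf_{\alpha>1}\,[\Delta_n(s,m;k\alpha)]^{1/\alpha}\,[\delta_n^\partial(s;\tfrac{\alpha}{\alpha-1})]^{1-1/\alpha}.$$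 For $a\ge1$ let $\mathcal L_a$ be the set of bounded functions $f:\mathbb R^a\to\mathbb R$ that are Lipschitz for the distance $\sum_{l\le a}|x_l-y_l|$, with sup-norm $\|f\|_\infty$ and smallest Lipschitz constant $\mathrm{Lip}(f)$. Conditional means, moments, variances and probabilities given $\mathcal C_n$ are those of regular conditional distributions. Write $\|X\|_{\mathcal C_n,p}=(\mathbf E[|X|^p\mid\mathcal C_n])^{1/p}$, $S_n=\sum_{i\in N_n}Y_{n,i}$ and $\sigma_n^2=\mathrm{Var}(S_n\mid\mathcal C_n)$. *Assumptions.* 1. (Conditional $\psi$-dependence.) There are $\mathcal C_n$-measurable $\theta_{n,s}\ge0$ ($s\ge0$), $\theta_{n,0}=1$, and nonrandom $\psi_{a,b}:\mathcal L_a\times\mathcal L_b\to[0,\infty)$ such that for all $n,a,b,s\ge1$, all $A,B\subseteq N_n$ with $|A|=a$, $|B|=b$, and all $f\in\mathcal L_a$, $g\in\mathcal L_b$, almost surely on the event $\{d_n(A,B)\ge s\}$, $$|\mathrm{Cov}(f(Y_{n,A}),g(Y_{n,B})\mid\mathcal C_n)|\le\psi_{a,b}(f,g)\,\theta_{n,s},\qquad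 Y_{n,A}=(Y_{n,i})_{i\in A}.$$ Moreover $\psi_{a,b}(f,g)\le C\,ab\,(\|f\|_\infty+\mathrm{Lip}(f))(\|g\|_\infty+\mathrm{Lip}(g))$ for some constant $C>0$, and $\sup_{n\ge1}\sup_{s\ge1}\theta_{n,s}<\infty$ a.s. 2. (No persistent dependence between components.) For each $n$, almost surely, $G_n$ is connected or $\theta_{n,s}\to0$ as $s\to\infty$. 3. (Moments.) For some $p>4$, $\sup_{n\ge1}\max_{i\in N_n}\|Y_{n,i}\|_{\mathcal C_n,p}<\infty$ a.s. 4. (Network.) Almost surely $\sigma_n>0$ for all large $n$, and there are positive integers $m_n\to\infty$ such that, as $n\to\infty$, for $k=1,2$, $$\frac{n}{\sigma_n^{2+k}}\sum_{s\ge0}c_n(s,m_n;k)\,\theta_{n,s}^{1-\frac{2+k}p}\to0\ \text{ a.s.},\qquad \frac{n^2\,\theta_{n,m_n}^{1-1/p}}{\sigma_n}\to0\ \text{ a.s.}$$ 5. (Centring.) $\mathbf E[Y_{n,i}\mid\mathcal C_n]=0$ a.s. for all $n$ and $i\in N_n$. *Conclusion.* $$\sup_{t\in\mathbb R}\left|\mathbf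 P\left\{\frac{S_n}{\sigma_n}\le t\,\Big|\,\mathcal C_n\right\}-\Phi(t)\right|\to0\quad\text{a.s. as }n\to\infty,$$ where $\Phi$ is the distribution function of $\mathcal N(0,1)$. -/

import Mathlib

open MeasureTheory ProbabilityTheory Filter Topology
open scoped NNReal ENNReal

noncomputable section

namespace NetCLT

/-! ### Networks: neighbourhoods, shells and the denseness measures -/

section Network

variable {n : ℕ}

open scoped Classical in
/-- `N(i; s)`: the nodes within distance `s` of `i`.  `SimpleGraph.edist` is the length of a
shortest path, with value `⊤` when there is no path. -/
def nbhd (G : SimpleGraph (Fin n)) (i : Fin n) (s : ℕ) : Finset (Fin n) :=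
  Finset.univ.filter fun j => G.edist i j ≤ (s : ℕ∞)

open scoped Classical in
/-- `N^∂(i; s)`: the nodes at distance exactly `s` from `i`. -/
def shell (G : SimpleGraph (Fin n)) (i : Fin n) (s : ℕ) : Finset (Fin n) :=
  Finset.univ.filter fun j => G.edist i j = (s : ℕ∞)

/-- `N(j; s - 1)`, with the convention that it is empty for `s = 0`. -/
def nbhdPred (G : SimpleGraph (Fin n)) (j : Fin n) : ℕ → Finset (Fin n)
  | 0 => ∅
  | s + 1 => nbhd G j s

/-- The distance `d(A, B) = min_{i ∈ A} min_{j ∈ B} d(i, j)` between two sets of nodes. -/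
def setDist (G : SimpleGraph (Fin n)) (A B : Finset (Fin n)) : ℕ∞ :=
  ⨅ i ∈ A, ⨅ j ∈ B, G.edist i j

/-- `δ^∂(s; k) = n⁻¹ ∑_i |N^∂(i; s)|^k`. -/
def deltaShell (G : SimpleGraph (Fin n)) (s : ℕ) (k : ℝ) : ℝ :=
  (n : ℝ)⁻¹ * ∑ i : Fin n, ((shell G i s).card : ℝ) ^ k

/-- `Δ(s, m; k) = n⁻¹ ∑_i max_{j ∈ N^∂(i; s)} |N(i; m) \ N(j; s - 1)|^k`.  The maximum over an
empty shell is `0`; the (positive) power is taken after the maximum. -/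
def Delta (G : SimpleGraph (Fin n)) (s m : ℕ) (k : ℝ) : ℝ :=
  (n : ℝ)⁻¹ * ∑ i : Fin n,
    (((shell G i s).sup fun j => (nbhd G i m \ nbhdPred G j s).card : ℕ) : ℝ) ^ k

/-- `c(s, m; k) = inf_{α > 1} Δ(s, m; k α)^{1/α} · δ^∂(s; α/(α-1))^{1 - 1/α}`. -/
def cNet (G : SimpleGraph (Fin n)) (s m : ℕ) (k : ℝ) : ℝ :=
  ⨅ α : Set.Ioi (1 : ℝ),
    Delta G s m (k * (α : ℝ)) ^ (1 / (α : ℝ)) *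
      deltaShell G s ((α : ℝ) / ((α : ℝ) - 1)) ^ (1 - 1 / (α : ℝ))

end Network

/-! ### Bounded Lipschitz functions of `a` points of `E = ℝ^v` -/

section BoundedLipschitz

variable (E : Type*) [NormedAddCommGroup E]

/-- The bounded functions `E^a → ℝ` that are Lipschitz for the distance `∑_l ‖x_l - y_l‖`. -/
def BddLip (a : ℕ) : Set ((Fin a → E) → ℝ) :=
  {f | (∃ M : ℝ, ∀ x, |f x| ≤ M) ∧
    ∃ K : ℝ, ∀ x y, |f x - f y| ≤ K * ∑ l, ‖x l - y l‖}

variable {E} {a : ℕ}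

/-- The sup-norm `‖f‖_∞`. -/
def supNorm (f : (Fin a → E) → ℝ) : ℝ := ⨆ x, |f x|

/-- The Lipschitz constant of `f` for the distance `∑_l ‖x_l - y_l‖`. -/
def lipConst (f : (Fin a → E) → ℝ) : ℝ :=
  sInf {K : ℝ | 0 ≤ K ∧ ∀ x y, |f x - f y| ≤ K * ∑ l, ‖x l - y l‖}

end BoundedLipschitz

/-! ### Conditioning -/

section Conditioning

variable {Ω : Type*}

/-- Conditional covariance `E[XZ | m] - E[X | m] E[Z | m]`; it is used for bounded `X`, `Z`. -/
def condCov (m : MeasurableSpace Ω) {mΩ : MeasurableSpace Ω} (μ : Measure Ω) (X Z : Ω → ℝ) : Ω → ℝ :=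
  fun ω => (μ[fun ω' => X ω' * Z ω' | m]) ω - (μ[X | m]) ω * (μ[Z | m]) ω

/-- The regular conditional distribution of the real random variable `X` given the
sub-σ-algebra `m`.  Conditional means, moments and variances are those of this law, so that they
make sense also for variables that are only conditionally integrable. -/
def condLaw (m : MeasurableSpace Ω) {mΩ : MeasurableSpace Ω} (μ : Measure Ω) [IsFiniteMeasure μ] (X : Ω → ℝ) :
    @Kernel Ω ℝ m inferInstance :=
  @condDistrib Ω Ω ℝ _ _ _ mΩ m X id μ _

/-- `E[X | m]`. -/
def condMean (m : MeasurableSpace Ω) {mΩ : MeasurableSpace Ω} (μ : Measure Ω) [IsFiniteMeasure μ] (X : Ω → ℝ) (ω : Ω) : ℝ :=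
  ∫ x, x ∂(condLaw m μ X ω)

/-- `‖X‖_{m, p} = (E[|X|^p | m])^{1/p}`, with values in `[0, ∞]`. -/
def condNorm (m : MeasurableSpace Ω) {mΩ : MeasurableSpace Ω} (μ : Measure Ω) [IsFiniteMeasure μ] (p : ℝ) (X : Ω → ℝ)
    (ω : Ω) : ℝ≥0∞ :=
  (∫⁻ x, ENNReal.ofReal (|x| ^ p) ∂(condLaw m μ X ω)) ^ (1 / p)

/-- `Var(X | m)`. -/
def condVariance (m : MeasurableSpace Ω) {mΩ : MeasurableSpace Ω} (μ : Measure Ω) [IsFiniteMeasure μ] (X : Ω → ℝ)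
    (ω : Ω) : ℝ :=
  variance (fun x : ℝ => x) (condLaw m μ X ω)

/-- The conditional distribution function `P(X ≤ t | m)`. -/
def condCdf (m : MeasurableSpace Ω) {mΩ : MeasurableSpace Ω} (μ : Measure Ω) [IsFiniteMeasure μ] (X : Ω → ℝ)
    (t : ℝ) (ω : Ω) : ℝ :=
  (condLaw m μ X ω).real (Set.Iic t)

end Conditioning

/-! ### Conditional ψ-dependence of a triangular array on a sequence of random networks -/

section Array

variable {Ω : Type*} [mΩ : MeasurableSpace Ω]

/-- `Y_{n,A} = (Y_{n,i})_{i ∈ A}` for a set `A` of `a` nodes, listed in increasing order. -/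
def subArray {E : Type*} {n a : ℕ} (Y : Fin n → Ω → E) (A : Finset (Fin n)) (hA : A.card = a)
    (ω : Ω) : Fin a → E :=
  fun l => Y (A.orderEmbOfFin hA l) ω

/-- The array `Y` on the networks `G` is conditionally ψ-dependent given the σ-fields `C`, with
dependence coefficients `θ` and functionals `ψ`. -/
structure IsCondPsiDependent {E : Type*} [NormedAddCommGroup E] (μ : Measure Ω)
    (C : ℕ → MeasurableSpace Ω) (G : (n : ℕ) → Ω → SimpleGraph (Fin n))
    (Y : (n : ℕ) → Fin n → Ω → E) (θ : ℕ → ℕ → Ω → ℝ≥0)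
    (ψ : (a b : ℕ) → BddLip E a → BddLip E b → ℝ≥0) : Prop where
  measurable_theta : ∀ n s, Measurable[C n] (θ n s)
  theta_zero : ∀ n, ∀ᵐ ω ∂μ, θ n 0 ω = 1
  abs_condCov_le : ∀ n a b s : ℕ, 0 < a → 0 < b → 0 < s →
    ∀ (A B : Finset (Fin n)) (hA : A.card = a) (hB : B.card = b)
      (f : BddLip E a) (g : BddLip E b),
      ∀ᵐ ω ∂μ, (s : ℕ∞) ≤ setDist (G n ω) A B →
        |condCov (C n) μ (fun ω' => f.1 (subArray (Y n) A hA ω'))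
          (fun ω' => g.1 (subArray (Y n) B hB ω')) ω| ≤ (ψ a b f g : ℝ) * (θ n s ω : ℝ)

/-- `S_n = ∑_i Y_{n,i}`. -/
def rowSum (Y : (n : ℕ) → Fin n → Ω → ℝ) (n : ℕ) (ω : Ω) : ℝ := ∑ i : Fin n, Y n i ω

/-- `σ_n = Var(S_n | C_n)^{1/2}`. -/
def sigma (μ : Measure Ω) [IsFiniteMeasure μ] (C : ℕ → MeasurableSpace Ω)
    (Y : (n : ℕ) → Fin n → Ω → ℝ) (n : ℕ) (ω : Ω) : ℝ :=
  √(condVariance (C n) μ (rowSum Y n) ω)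

end Array

end NetCLT

end

/-! Fix an outcome ω outside a null set and replace the array by the regular conditional laws
`rowLaw` on ℝ^n. Everything then becomes an estimate for a deterministic network and a single law
(`PsiDependentLaw`), with constants independent of n. ψ-dependence passes to these laws because it
is used only for a countable family of test functions, so that the exceptional null sets add up to a
null set.

For such a law, Stein's method gives the CLT. Write S = D_i + S_i', where D_i collects the nodes
within distance m of i. For f(x) = cos(ux + c) on the scale of S/σ, E[S f(S/σ)] is the sum of the
E[Y_i f(S/σ)], and expanding f about S/σ leaves three errors. The far terms E[Y_i f(S_i'/σ)] are
small because Y_i is centred and nearly independent of S_i'; they cost n²θ_m^{1-1/p}/σ. The Taylor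
remainder is at most a multiple of the sum of E[|Y_i| D_i²], which is a sum over triples. Finally,
σ² has to be compared with Z = ∑ Y_i D_i: the gap σ² - E Z is a sum over distant pairs, and Var Z is
a sum over quadruples. These are bounded in `abs_integral_stein_le`, and
`norm_charFun_sub_gaussian_le` turns the result into closeness of characteristic functions.

Two ingredients make the sums finite quantities of the network. Truncation at a level of order
θ^{-1/p} turns ψ-dependence of bounded Lipschitz functions into covariance bounds θ^{1-r/p} for
products of r ≤ 4 coordinates (`PsiDependentLaw.abs_cov_le`). Grouping triples and quadruples by the
closest cross pair, then applying Hölder's inequality, bounds the sums of these coefficients by n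
∑_s c(s, m; k) θ_s^{1-(2+k)/p}, with k = 1 and k = 2 (`sum_triple_le`, `sum_quadruple_le`).

Convergence of characteristic functions gives weak convergence, and continuity of Φ makes the
convergence of distribution functions uniform. -/

/-! ### From characteristic functions to uniform convergence of distribution functions -/

theorem continuous_cdf (ν : Measure ℝ) [IsProbabilityMeasure ν] [NullSingletonClass ν] :
    Continuous (cdf ν) := by
  refine continuous_iff_continuousAt.2 fun x => ?_
  rw [(monotone_cdf ν).continuousAt_iff_leftLim_eq_rightLim]
  have h := (cdf ν).measure_singleton x
  rw [measure_cdf, measure_singleton, eq_comm, ENNReal.ofReal_eq_zero] at h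
  have h2 : Function.rightLim (cdf ν) x = cdf ν x := (cdf ν).rightLim_eq x
  rw [h2]
  exact le_antisymm ((monotone_cdf ν).leftLim_le le_rfl) (by linarith)

/-- Pointwise convergence of distribution functions to a continuous one is uniform. -/
theorem tendsto_iSup_abs_sub_of_monotone {F : ℕ → ℝ → ℝ} {Φ : ℝ → ℝ}
    (hF : ∀ n, Monotone (F n)) (hF0 : ∀ n t, 0 ≤ F n t) (hF1 : ∀ n t, F n t ≤ 1)
    (hΦm : Monotone Φ) (hΦ : Continuous Φ) (hbot : Tendsto Φ atBot (𝓝 0))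
    (htop : Tendsto Φ atTop (𝓝 1)) (h : ∀ t, Tendsto (fun n => F n t) atTop (𝓝 (Φ t))) :
    Tendsto (fun n => ⨆ t, |F n t - Φ t|) atTop (𝓝 0) := by
  have hΦ0 : ∀ t, 0 ≤ Φ t := hΦm.le_of_tendsto hbot
  have hΦ1 : ∀ t, Φ t ≤ 1 := hΦm.ge_of_tendsto htop
  have hsurj : ∀ q : ℝ, 0 < q → q < 1 → ∃ t, Φ t = q := by
    intro q h0 h1
    refine mem_range_of_exists_le_of_exists_ge hΦ ?_ ?_
    · obtain ⟨t, ht⟩ := (hbot.eventually (gt_mem_nhds h0)).exists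
      exact ⟨t, ht.le⟩
    · obtain ⟨t, ht⟩ := (htop.eventually (lt_mem_nhds h1)).exists
      exact ⟨t, ht.le⟩
  choose! τ hτ using hsurj
  rw [Metric.tendsto_atTop']
  intro ε hε
  -- The quantiles τ(j/k) cut the line into k cells of Φ-mass 1/k. Beyond the error ε/4 at the grid
  -- points, monotonicity loses at most 2/k < ε/2, whence the bound 3ε/4 in `key`.
  obtain ⟨k, hk⟩ := exists_nat_gt (4 / ε)
  have hkpos : (0 : ℝ) < k := lt_trans (by positivity) hk
  have hkε : 2 / (k : ℝ) < ε / 2 := by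
    rw [div_lt_iff₀ hε] at hk
    rw [div_lt_iff₀ hkpos]; linarith
  have hev : ∀ᶠ n in atTop, ∀ j ∈ Finset.range k, |F n (τ (j / k)) - Φ (τ (j / k))| < ε / 4 := by
    rw [eventually_all_finset]
    intro j _
    have := (h (τ (j / k))).sub_const (Φ (τ (j / k)))
    rw [sub_self] at this
    have := this.abs
    rw [abs_zero] at this
    exact this.eventually (gt_mem_nhds (by positivity))
  obtain ⟨N, hN⟩ := eventually_atTop.1 hev
  refine ⟨N, fun n hn => ?_⟩
  have key : ∀ t, |F n t - Φ t| ≤ 3 * ε / 4 := by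
    intro t
    set j := ⌊(k : ℝ) * Φ t⌋₊ with hj
    have hj0 : 0 ≤ (k : ℝ) * Φ t := mul_nonneg hkpos.le (hΦ0 t)
    have hj1 : (j : ℝ) ≤ k * Φ t := Nat.floor_le hj0
    have hj2 : (k : ℝ) * Φ t < j + 1 := Nat.lt_floor_add_one _
    have hkinv : (k : ℝ) * (1 / k) = 1 := by field_simp
    have h2k : 2 / (k : ℝ) = 2 * (1 / k) := by ring
    have hone : 0 < 1 / (k : ℝ) := by positivity
    have hup : F n t ≤ Φ t + 1 / k + ε / 4 := by
      by_cases hjk : j + 1 < k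
      · have hq0 : (0 : ℝ) < ((j + 1 : ℕ) : ℝ) / k := by positivity
        have hq1 : ((j + 1 : ℕ) : ℝ) / k < 1 := by
          rw [div_lt_one hkpos]; exact_mod_cast hjk
        have e := hτ _ hq0 hq1
        have hlt : Φ t < Φ (τ (((j + 1 : ℕ) : ℝ) / k)) := by
          rw [e, lt_div_iff₀ hkpos]; push_cast; linarith
        have hle := hF n (hΦm.reflect_lt hlt).le
        have hb := hN n hn.le (j + 1) (Finset.mem_range.2 hjk)
        rw [abs_lt] at hb
        rw [e] at hb
        have : ((j + 1 : ℕ) : ℝ) / k ≤ Φ t + 1 / k := by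
          rw [div_le_iff₀ hkpos]; push_cast; nlinarith
        linarith
      · have : (k : ℝ) ≤ j + 1 := by exact_mod_cast not_lt.1 hjk
        have : (1 : ℝ) ≤ Φ t + 1 / k := by
          by_contra hcon
          push Not at hcon
          nlinarith
        linarith [hF1 n t]
    -- The grid point is (j - 1)/k, since Φ t may equal j/k and τ(j/k) need not then lie to the left
    -- of t. This costs 2/k instead of 1/k. When j ≤ 1, Φ t itself is at most 2/k.
    have hlo : Φ t - 2 / k - ε / 4 ≤ F n t := by
      by_cases hj' : 2 ≤ j
      · have hq0 : (0 : ℝ) < ((j - 1 : ℕ) : ℝ) / k := by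
          have : 0 < j - 1 := by omega
          positivity
        have hc : ((j - 1 : ℕ) : ℝ) = j - 1 := by
          rw [Nat.cast_sub (by omega)]; simp
        have hq2 : ((j - 1 : ℕ) : ℝ) / k < Φ t := by
          rw [div_lt_iff₀ hkpos, hc]; linarith
        have hq1 : ((j - 1 : ℕ) : ℝ) / k < 1 := hq2.trans_le (hΦ1 t)
        have e := hτ _ hq0 hq1
        have hlt : Φ (τ (((j - 1 : ℕ) : ℝ) / k)) < Φ t := by rw [e]; exact hq2
        have hle := hF n (hΦm.reflect_lt hlt).le
        have hjk : j - 1 < k := by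
          rw [div_lt_one hkpos] at hq1; exact_mod_cast hq1
        have hb := hN n hn.le (j - 1) (Finset.mem_range.2 hjk)
        rw [abs_lt] at hb
        rw [e] at hb
        have : Φ t - 2 / k ≤ ((j - 1 : ℕ) : ℝ) / k := by
          rw [le_div_iff₀ hkpos, hc, h2k]; nlinarith
        linarith
      · have : (j : ℝ) ≤ 1 := by exact_mod_cast (by omega : j ≤ 1)
        have : Φ t ≤ 2 / k := by
          rw [le_div_iff₀ hkpos]; linarith
        linarith [hF0 n t]
    rw [abs_le]
    constructor <;> linarith
  rw [Real.dist_eq, sub_zero, abs_of_nonneg (Real.iSup_nonneg fun t => abs_nonneg _)]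
  exact lt_of_le_of_lt (ciSup_le key) (by linarith)

theorem tendsto_iSup_abs_sub_cdf_gaussian (ν : ℕ → Measure ℝ) [∀ n, IsProbabilityMeasure (ν n)]
    (h : ∀ t, Tendsto (fun n => charFun (ν n) t) atTop (𝓝 (charFun (gaussianReal 0 1) t))) :
    Tendsto (fun n => ⨆ t : ℝ, |(ν n).real (Set.Iic t) - cdf (gaussianReal 0 1) t|)
      atTop (𝓝 0) := by
  have : NullSingletonClass (gaussianReal 0 1) := nullSingletonClass_gaussianReal (by simp)
  refine tendsto_iSup_abs_sub_of_monotone (fun n s t hst => measureReal_mono (Set.Iic_subset_Iic.2 hst))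
    (fun n t => measureReal_nonneg) (fun n t => measureReal_le_one) (monotone_cdf _)
    (continuous_cdf _) (tendsto_cdf_atBot _) (tendsto_cdf_atTop _) fun t => ?_
  have hw := ProbabilityMeasure.tendsto_of_tendsto_charFun
    (μ := fun n => (⟨ν n, inferInstance⟩ : ProbabilityMeasure ℝ))
    (μ₀ := ⟨gaussianReal 0 1, inferInstance⟩) h
  have := ProbabilityMeasure.tendsto_measure_of_null_frontier_of_tendsto' hw (E := Set.Iic t)
    (by simp)
  have h2 := (ENNReal.tendsto_toReal (measure_ne_top (gaussianReal 0 1) _)).comp this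
  rw [cdf_eq_real]
  exact h2

/-! ### Stein's equation for characteristic functions -/

/-- The function φ(u) e^{u²/2} is constant for the standard Gaussian. In general its derivative is i
e^{u²/2} E[(X - iu) e^{iuX}], and the real and imaginary parts of this expectation are the integrals
in `hε` with c = 0 and c = -π/2. The mean value inequality on [0, t] produces a factor e^{t²/2},
which cancels upon dividing by it. -/
theorem norm_charFun_sub_gaussian_le (μ : Measure ℝ) [IsProbabilityMeasure μ]
    (hμ : Integrable (fun x : ℝ => x) μ) {ε t : ℝ}
    (hε : ∀ u, |u| ≤ |t| → ∀ c : ℝ, c = 0 ∨ c = -(Real.pi / 2) →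
      |∫ x, (x * Real.cos (u * x + c) + u * Real.sin (u * x + c)) ∂μ| ≤ ε) :
    ‖charFun μ t - charFun (gaussianReal 0 1) t‖ ≤ 2 * |t| * ε := by
  have hbdd : ∀ u : ℝ, Integrable (fun x : ℝ => Complex.exp (u * x * Complex.I)) μ := by
    intro u
    refine Integrable.of_bound (by fun_prop) 1 (ae_of_all _ fun x => ?_)
    have : (u * x * Complex.I : ℂ) = ((u * x : ℝ) : ℂ) * Complex.I := by push_cast; ring
    rw [this, Complex.norm_exp_ofReal_mul_I]
  have hxint : ∀ u : ℝ, Integrable (fun x : ℝ => (x : ℂ) * Complex.exp (u * x * Complex.I)) μ := by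
    intro u
    refine hμ.mono (by fun_prop) (ae_of_all _ fun x => ?_)
    have : (u * x * Complex.I : ℂ) = ((u * x : ℝ) : ℂ) * Complex.I := by push_cast; ring
    rw [norm_mul, this, Complex.norm_exp_ofReal_mul_I, mul_one, Complex.norm_real]
  have hderiv : ∀ u : ℝ, HasDerivAt (charFun μ)
      (∫ x : ℝ, ((x : ℂ) * Complex.exp (u * x * Complex.I)) * Complex.I ∂μ) u := by
    intro u
    have hEq : charFun μ = fun u : ℝ => ∫ x : ℝ, Complex.exp (u * x * Complex.I) ∂μ := by
      ext u; rw [charFun_apply_real]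
    rw [hEq]
    refine (hasDerivAt_integral_of_dominated_loc_of_deriv_le (bound := fun x => |x|)
      (F := fun (u : ℝ) (x : ℝ) => Complex.exp (u * x * Complex.I))
      (F' := fun (u : ℝ) (x : ℝ) => ((x : ℂ) * Complex.exp (u * x * Complex.I)) * Complex.I)
      (s := Set.univ) univ_mem (Eventually.of_forall fun u => by fun_prop) (hbdd u) (by fun_prop)
      (ae_of_all _ fun x u _ => ?_) hμ.abs (ae_of_all _ fun x u _ => ?_)).2
    · have : (u * x * Complex.I : ℂ) = ((u * x : ℝ) : ℂ) * Complex.I := by push_cast; ring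
      rw [norm_mul, norm_mul, this, Complex.norm_exp_ofReal_mul_I]
      simp
    · have h1 : HasDerivAt (fun u : ℝ => ((u : ℂ) * x * Complex.I)) (1 * x * Complex.I) u :=
        ((Complex.ofRealCLM.hasDerivAt (x := u)).mul_const (x : ℂ)).mul_const Complex.I
      have h2 := h1.cexp
      rwa [show Complex.exp ((u : ℂ) * x * Complex.I) * (1 * x * Complex.I)
        = (x : ℂ) * Complex.exp (u * x * Complex.I) * Complex.I by ring] at h2
  have hG : ∀ u : ℝ, charFun (gaussianReal 0 1) u = Complex.exp (-(u ^ 2 / 2)) := by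
    intro u
    rw [charFun_gaussianReal]
    congr 1
    push_cast
    simp
  have hg : ∀ u : ℝ, HasDerivAt (fun u : ℝ => charFun μ u * Complex.exp (u ^ 2 / 2))
      ((∫ x : ℝ, ((x : ℂ) * Complex.exp (u * x * Complex.I)) * Complex.I ∂μ)
        * Complex.exp (u ^ 2 / 2) + charFun μ u * (Complex.exp (u ^ 2 / 2) * u)) u := by
    intro u
    refine (hderiv u).mul ?_
    have h1 : HasDerivAt (fun u : ℝ => ((u : ℂ) ^ 2 / 2)) (u : ℂ) u := by
      have := ((Complex.ofRealCLM.hasDerivAt (x := u)).pow 2).div_const 2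
      refine this.congr_deriv ?_
      simp
    exact h1.cexp
  have hbound : ∀ u, |u| ≤ |t| →
      ‖(∫ x : ℝ, ((x : ℂ) * Complex.exp (u * x * Complex.I)) * Complex.I ∂μ)
        * Complex.exp (u ^ 2 / 2) + charFun μ u * (Complex.exp (u ^ 2 / 2) * u)‖
        ≤ 2 * ε * Real.exp (t ^ 2 / 2) := by
    intro u hu
    set J : ℂ := ∫ x : ℝ, ((x : ℂ) * Complex.exp (u * x * Complex.I)
      - u * Complex.I * Complex.exp (u * x * Complex.I)) ∂μ with hJ
    have hJint : Integrable (fun x : ℝ => ((x : ℂ) * Complex.exp (u * x * Complex.I)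
      - u * Complex.I * Complex.exp (u * x * Complex.I))) μ := (hxint u).sub ((hbdd u).const_mul _)
    have hsplit : (∫ x : ℝ, ((x : ℂ) * Complex.exp (u * x * Complex.I)) * Complex.I ∂μ)
        * Complex.exp (u ^ 2 / 2) + charFun μ u * (Complex.exp (u ^ 2 / 2) * u)
        = J * Complex.I * Complex.exp (u ^ 2 / 2) := by
      rw [hJ, integral_sub (hxint u) ((hbdd u).const_mul _), integral_mul_const,
        integral_const_mul, charFun_apply_real]
      linear_combination ((u : ℂ) * (∫ x : ℝ, Complex.exp (u * x * Complex.I) ∂μ)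
        * Complex.exp (u ^ 2 / 2)) * Complex.I_sq
    have hexp : ∀ x : ℝ, Complex.exp (u * x * Complex.I)
        = (Real.cos (u * x) : ℂ) + (Real.sin (u * x) : ℂ) * Complex.I := by
      intro x
      rw [← Complex.ofReal_mul, Complex.exp_mul_I, Complex.ofReal_cos, Complex.ofReal_sin]
    have hre : J.re = ∫ x, (x * Real.cos (u * x + 0) + u * Real.sin (u * x + 0)) ∂μ := by
      rw [hJ, ← RCLike.re_eq_complex_re, ← integral_re hJint]
      refine integral_congr_ae (ae_of_all _ fun x => ?_)
      simp only [hexp]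
      simp [-Complex.ofReal_cos, -Complex.ofReal_sin]
    have him : J.im = ∫ x, (x * Real.cos (u * x + -(Real.pi / 2))
        + u * Real.sin (u * x + -(Real.pi / 2))) ∂μ := by
      rw [hJ, ← RCLike.im_eq_complex_im, ← integral_im hJint]
      refine integral_congr_ae (ae_of_all _ fun x => ?_)
      simp only [hexp, ← sub_eq_add_neg, Real.cos_sub_pi_div_two, Real.sin_sub_pi_div_two]
      simp [-Complex.ofReal_cos, -Complex.ofReal_sin]
      try ring
    have hJn : ‖J‖ ≤ 2 * ε := by
      refine (Complex.norm_le_abs_re_add_abs_im J).trans ?_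
      rw [hre, him]
      linarith [hε u hu 0 (Or.inl rfl), hε u hu _ (Or.inr rfl)]
    have hε0 : 0 ≤ 2 * ε := (norm_nonneg _).trans hJn
    have hu2 : Complex.exp ((u : ℂ) ^ 2 / 2) = ((Real.exp (u ^ 2 / 2) : ℝ) : ℂ) := by
      push_cast; rfl
    rw [hsplit, norm_mul, norm_mul, Complex.norm_I, mul_one, hu2, Complex.norm_real,
      Real.norm_of_nonneg (Real.exp_pos _).le]
    have : u ^ 2 ≤ t ^ 2 := sq_le_sq.2 hu
    gcongr
  have hmv := Convex.norm_image_sub_le_of_norm_hasDerivWithin_le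
    (f := fun u : ℝ => charFun μ u * Complex.exp (u ^ 2 / 2)) (s := Set.uIcc 0 t) (x := 0) (y := t)
    (fun u _ => (hg u).hasDerivWithinAt)
    (fun u hu => hbound u (by
      have := Set.abs_sub_left_of_mem_uIcc hu
      simpa using this)) (convex_uIcc 0 t)
    Set.left_mem_uIcc Set.right_mem_uIcc
  simp only [charFun_zero, Complex.ofReal_zero] at hmv
  have h1 : charFun μ t - charFun (gaussianReal 0 1) t
      = (charFun μ t * Complex.exp (t ^ 2 / 2) - 1) * ((Real.exp (-(t ^ 2 / 2)) : ℝ) : ℂ) := by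
    rw [hG]
    push_cast
    rw [sub_mul, mul_assoc, ← Complex.exp_add]
    simp
  rw [h1, norm_mul, Complex.norm_real, Real.norm_of_nonneg (Real.exp_pos _).le]
  have h2 : ‖charFun μ t * Complex.exp (t ^ 2 / 2) - 1‖ ≤ 2 * ε * Real.exp (t ^ 2 / 2) * |t| := by
    simpa using hmv
  calc _ ≤ 2 * ε * Real.exp (t ^ 2 / 2) * |t| * Real.exp (-(t ^ 2 / 2)) := by gcongr
    _ = 2 * |t| * ε * (Real.exp (t ^ 2 / 2) * Real.exp (-(t ^ 2 / 2))) := by ring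
    _ = _ := by rw [← Real.exp_add]; simp

namespace NetCLT

/-! ### Counting pairs, triples and quadruples of nodes by distance -/

section Counting

variable {n : ℕ} (G : SimpleGraph (Fin n))

theorem mem_nbhd {i j : Fin n} {s : ℕ} : j ∈ nbhd G i s ↔ G.edist i j ≤ s := by
  simp [nbhd]

theorem mem_shell {i j : Fin n} {s : ℕ} : j ∈ shell G i s ↔ G.edist i j = s := by
  simp [shell]

theorem notMem_nbhdPred {i j : Fin n} {s : ℕ} : j ∉ nbhdPred G i s ↔ (s : ℕ∞) ≤ G.edist i j := by
  cases s with
  | zero => simp [nbhdPred]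
  | succ s =>
    rw [nbhdPred, mem_nbhd, not_le, Nat.cast_succ]
    exact (ENat.add_one_le_iff (ENat.natCast_ne_top s)).symm

/-- `max_{j ∈ N^∂(i; s)} |N(i; m) \ N(j; s - 1)|`. -/
noncomputable def shellMax (m : ℕ) (i : Fin n) (s : ℕ) : ℕ :=
  (shell G i s).sup fun j => (nbhd G i m \ nbhdPred G j s).card

theorem cNet_term_nonneg (s m : ℕ) (k : ℝ) (α : ℝ) :
    0 ≤ Delta G s m (k * α) ^ (1 / α) * deltaShell G s (α / (α - 1)) ^ (1 - 1 / α) := by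
  unfold Delta deltaShell
  positivity

theorem cNet_nonneg (s m : ℕ) (k : ℝ) : 0 ≤ cNet G s m k :=
  Real.iInf_nonneg fun α => cNet_term_nonneg G s m k α

/-- Hölder's inequality with exponents α and α/(α-1), for each α > 1 in the infimum; the factor 1/n
splits into the matching powers. -/
theorem sum_shellMax_le_cNet (s m : ℕ) {k : ℕ} :
    (n : ℝ)⁻¹ * ∑ i, (shellMax G m i s : ℝ) ^ k * ((shell G i s).card : ℝ) ≤ cNet G s m k := by
  have : Nonempty (Set.Ioi (1 : ℝ)) := ⟨⟨2, by norm_num⟩⟩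
  refine le_ciInf fun α => ?_
  obtain ⟨α, hα⟩ := α
  have hα1 : 1 < α := hα
  have hα0 : 0 < α := by linarith
  have hconj : α.HolderConjugate (α / (α - 1)) := Real.HolderConjugate.conjExponent hα1
  have hH := Real.inner_le_Lp_mul_Lq Finset.univ
    (fun i => (shellMax G m i s : ℝ) ^ k) (fun i => ((shell G i s).card : ℝ)) hconj
  have hinv : 1 / (α / (α - 1)) = 1 - 1 / α := by
    have : α - 1 ≠ 0 := by linarith
    field_simp
  rw [hinv] at hH
  have hn : ((n : ℝ)⁻¹) = (n : ℝ)⁻¹ ^ (1 / α) * (n : ℝ)⁻¹ ^ (1 - 1 / α) := by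
    have h1 : 0 ≤ 1 / α := by positivity
    have h2 : 0 ≤ 1 - 1 / α := by rw [sub_nonneg, div_le_one hα0]; exact hα1.le
    rw [← Real.rpow_add_of_nonneg (by positivity) h1 h2]
    simp
  have hpow : ∀ i, |(shellMax G m i s : ℝ) ^ k| ^ α = (shellMax G m i s : ℝ) ^ ((k : ℝ) * α) := by
    intro i
    rw [abs_of_nonneg (by positivity), ← Real.rpow_natCast, ← Real.rpow_mul (by positivity)]
  simp only [hpow, Nat.abs_cast] at hH
  change _ ≤ Delta G s m ((k : ℝ) * α) ^ (1 / α) * deltaShell G s (α / (α - 1)) ^ (1 - 1 / α)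
  unfold Delta deltaShell
  rw [Real.mul_rpow (by positivity) (by positivity), Real.mul_rpow (by positivity) (by positivity)]
  calc _ ≤ (n : ℝ)⁻¹ * _ := mul_le_mul_of_nonneg_left hH (by positivity)
    _ = _ := by
      conv_lhs => rw [hn]
      simp only [shellMax]
      ring

theorem edist_toNat_le (i j : Fin n) :
    (G.edist i j).toNat ≤ Finset.univ.sup fun q : Fin n × Fin n => (G.edist q.1 q.2).toNat :=
  Finset.le_sup (f := fun q : Fin n × Fin n => (G.edist q.1 q.2).toNat) (Finset.mem_univ (i, j))

/-- As `toNat` sends ⊤ to 0, the supremum is the largest finite distance, and all shells beyond it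
are empty. The series over s are therefore finite sums, and `tsum` never takes its default value. -/
theorem cNet_eq_zero {s : ℕ} (m : ℕ) (k : ℝ)
    (hs : (Finset.univ.sup fun q : Fin n × Fin n => (G.edist q.1 q.2).toNat) < s) :
    cNet G s m k = 0 := by
  have hshell : ∀ i, shell G i s = ∅ := by
    intro i
    refine Finset.eq_empty_of_forall_notMem fun j hj => ?_
    rw [mem_shell] at hj
    have := edist_toNat_le G i j
    rw [hj, ENat.toNat_natCast] at this
    omega
  refine le_antisymm ?_ (cNet_nonneg G s m k)
  refine (ciInf_le ⟨0, ?_⟩ (⟨2, by norm_num⟩ : Set.Ioi (1 : ℝ))).trans ?_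
  · rintro _ ⟨α, rfl⟩
    exact cNet_term_nonneg G s m k α
  · norm_num [deltaShell, hshell]

theorem summable_cNet_mul (m : ℕ) (k : ℝ) (w : ℕ → ℝ) :
    Summable fun s => cNet G s m k * w s :=
  summable_of_ne_finset_zero
    (s := Finset.range ((Finset.univ.sup fun q : Fin n × Fin n => (G.edist q.1 q.2).toNat) + 1))
    fun s hs => by
      rw [cNet_eq_zero G m k (by simpa using hs), zero_mul]

variable {w : ℕ∞ → ℝ}

/-- Pairs at finite distance are grouped by shells. Pairs at infinite distance, which `toNat` would
place at 0, are removed by `hw'`. -/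
theorem sum_edist_le (hw : ∀ e, 0 ≤ w e) (hw' : w ⊤ = 0) (m k : ℕ) :
    ∑ i, ∑ j, w (G.edist i j) * (shellMax G m i (G.edist i j).toNat : ℝ) ^ k
      ≤ n * ∑' s : ℕ, cNet G s m k * w s := by
  set S := Finset.range ((Finset.univ.sup fun q : Fin n × Fin n => (G.edist q.1 q.2).toNat) + 1)
  have hpt : ∀ i j, w (G.edist i j) * (shellMax G m i (G.edist i j).toNat : ℝ) ^ k
      ≤ ∑ s ∈ S, if j ∈ shell G i s then w s * (shellMax G m i s : ℝ) ^ k else 0 := by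
    intro i j
    have hnn : ∀ s ∈ S, 0 ≤ if j ∈ shell G i s then w s * (shellMax G m i s : ℝ) ^ k else 0 := by
      intro s _
      split_ifs
      · exact mul_nonneg (hw _) (by positivity)
      · exact le_rfl
    by_cases htop : G.edist i j = ⊤
    · rw [htop, hw', zero_mul]
      exact Finset.sum_nonneg hnn
    · obtain ⟨s, hs⟩ := ENat.ne_top_iff_exists.1 htop
      have hsS : s ∈ S := by
        have := edist_toNat_le G i j
        rw [← hs, ENat.toNat_natCast] at this
        exact Finset.mem_range.2 (by omega)
      refine le_trans (le_of_eq ?_) (Finset.single_le_sum hnn hsS)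
      rw [if_pos ((mem_shell G).2 hs.symm), ← hs, ENat.toNat_natCast]
  calc _ ≤ ∑ i, ∑ j, ∑ s ∈ S, if j ∈ shell G i s then w s * (shellMax G m i s : ℝ) ^ k else 0 :=
        Finset.sum_le_sum fun i _ => Finset.sum_le_sum fun j _ => hpt i j
    _ = ∑ s ∈ S, w s * ∑ i, (shellMax G m i s : ℝ) ^ k * ((shell G i s).card : ℝ) := by
        rw [Finset.sum_congr rfl fun i _ => Finset.sum_comm, Finset.sum_comm]
        refine Finset.sum_congr rfl fun s _ => ?_
        rw [Finset.mul_sum]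
        refine Finset.sum_congr rfl fun i _ => ?_
        rw [Finset.sum_ite_mem, Finset.univ_inter, Finset.sum_const, nsmul_eq_mul]
        ring
    _ ≤ ∑ s ∈ S, n * (cNet G s m k * w s) := by
        refine Finset.sum_le_sum fun s _ => ?_
        rcases Nat.eq_zero_or_pos n with rfl | hn
        · simp
        · have hn' : (0 : ℝ) < n := by exact_mod_cast hn
          have := sum_shellMax_le_cNet G s m (k := k)
          rw [inv_mul_le_iff₀ hn'] at this
          calc _ ≤ w s * (n * cNet G s m k) := mul_le_mul_of_nonneg_left this (hw _)
            _ = _ := by ring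
    _ ≤ _ := by
        rw [← Finset.mul_sum]
        exact mul_le_mul_of_nonneg_left ((summable_cNet_mul G m k fun s => w s).sum_le_tsum _
          fun s _ => mul_nonneg (cNet_nonneg G s m k) (hw _)) (by positivity)

theorem tsum_cNet_mul_nonneg (hw : ∀ e, 0 ≤ w e) (m k : ℕ) :
    0 ≤ ∑' s : ℕ, cNet G s m k * w s :=
  tsum_nonneg fun s => mul_nonneg (cNet_nonneg G s m k) (hw _)

/-- This is where the set differences in Δ arise: they count the companions of i within range m that
are no closer to k than i is. -/
theorem card_le_shellMax {i k : Fin n} {m s : ℕ} (hs : G.edist i k = s) (T : Finset (Fin n))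
    (hT : ∀ j ∈ T, G.edist i j ≤ m ∧ (s : ℕ∞) ≤ G.edist k j) : T.card ≤ shellMax G m i s := by
  refine le_trans (Finset.card_le_card fun j hj => ?_)
    (Finset.le_sup (f := fun j => (nbhd G i m \ nbhdPred G j s).card) ((mem_shell G).2 hs))
  rw [Finset.mem_sdiff, mem_nbhd, notMem_nbhdPred]
  exact hT j hj

/-- Summing over pairs. -/
theorem sum_pair_le (hw : ∀ e, 0 ≤ w e) (hw' : w ⊤ = 0) (m : ℕ) :
    ∑ i, ∑ j, w (G.edist i j) ≤ n * ∑' s : ℕ, cNet G s m ((1 : ℕ) : ℝ) * w s := by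
  refine le_trans (Finset.sum_le_sum fun i _ => Finset.sum_le_sum fun j _ => ?_)
    (sum_edist_le G hw hw' m 1)
  by_cases htop : G.edist i j = ⊤
  · simp [htop, hw']
  · obtain ⟨s, hs⟩ := ENat.ne_top_iff_exists.1 htop
    -- The node i itself belongs to N(i; m) \ N(j; s - 1).
    have h1 : 1 ≤ shellMax G m i s := by
      refine card_le_shellMax G (k := j) hs.symm {i} fun l hl => ?_
      rw [Finset.mem_singleton.1 hl, SimpleGraph.edist_self, SimpleGraph.edist_comm, ← hs]
      simp
    rw [← hs, ENat.toNat_natCast, pow_one]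
    exact le_mul_of_one_le_right (hw _) (by exact_mod_cast h1)

open scoped Classical in
/-- Summing over triples `(i, j, k)` with `i` and `j` close, according to the distance from `k`
to `{i, j}`. -/
theorem sum_triple_le (hw : ∀ e, 0 ≤ w e) (hw' : w ⊤ = 0) (m : ℕ) :
    ∑ i, ∑ j, ∑ k, (if G.edist i j ≤ m then w (min (G.edist k i) (G.edist k j)) else 0)
      ≤ 2 * (n * ∑' s : ℕ, cNet G s m ((1 : ℕ) : ℝ) * w s) := by
  -- The node k is charged to the nearer of i and j, here i; the companion j is then counted by
  -- `card_le_shellMax`. Exchanging i and j gives the factor 2.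
  set T : Fin n → Fin n → Fin n → ℝ := fun i j k =>
    if G.edist i j ≤ m ∧ G.edist i k ≤ G.edist k j then w (G.edist i k) else 0 with hT
  have hTnn : ∀ i j k, 0 ≤ T i j k := by
    intro i j k
    simp only [hT]
    split_ifs
    · exact hw _
    · exact le_rfl
  have hpt : ∀ i j k, (if G.edist i j ≤ m then w (min (G.edist k i) (G.edist k j)) else 0)
      ≤ T i j k + T j i k := by
    intro i j k
    by_cases hm : G.edist i j ≤ m
    · rw [if_pos hm]
      rcases le_total (G.edist k i) (G.edist k j) with h | h
      · have : T i j k = w (G.edist k i) := by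
          simp only [hT]
          rw [if_pos ⟨hm, by rwa [SimpleGraph.edist_comm (u := i)]⟩, SimpleGraph.edist_comm]
        rw [min_eq_left h, this]
        linarith [hTnn j i k]
      · have : T j i k = w (G.edist k j) := by
          simp only [hT]
          rw [if_pos ⟨by rwa [SimpleGraph.edist_comm], by rwa [SimpleGraph.edist_comm (u := j)]⟩,
            SimpleGraph.edist_comm]
        rw [min_eq_right h, this]
        linarith [hTnn i j k]
    · rw [if_neg hm]
      exact add_nonneg (hTnn _ _ _) (hTnn _ _ _)
  have hsum : ∑ i, ∑ j, ∑ k, T i j k ≤ n * ∑' s : ℕ, cNet G s m ((1 : ℕ) : ℝ) * w s := by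
    refine le_trans (Finset.sum_le_sum fun i _ => ?_) (sum_edist_le G hw hw' m 1)
    rw [Finset.sum_comm]
    refine Finset.sum_le_sum fun k _ => ?_
    simp only [hT]
    rw [← Finset.sum_filter, Finset.sum_const, nsmul_eq_mul, mul_comm, pow_one]
    by_cases htop : G.edist i k = ⊤
    · simp [htop, hw']
    · obtain ⟨s, hs⟩ := ENat.ne_top_iff_exists.1 htop
      rw [← hs, ENat.toNat_natCast]
      refine mul_le_mul_of_nonneg_left (Nat.cast_le.2 ?_) (hw _)
      exact card_le_shellMax G (k := k) hs.symm _ fun j hj => (Finset.mem_filter.1 hj).2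
  calc _ ≤ ∑ i, ∑ j, ∑ k, (T i j k + T j i k) :=
        Finset.sum_le_sum fun i _ => Finset.sum_le_sum fun j _ => Finset.sum_le_sum fun k _ =>
          hpt i j k
    _ = ∑ i, ∑ j, ∑ k, T i j k + ∑ i, ∑ j, ∑ k, T j i k := by
        simp only [Finset.sum_add_distrib]
    _ = 2 * ∑ i, ∑ j, ∑ k, T i j k := by
        rw [Finset.sum_comm (f := fun i j => ∑ k, T j i k)]; ring
    _ ≤ _ := by linarith

open scoped Classical in
/-- Summing over quadruples `(i, j, k, l)` with `i`, `j` close and `k`, `l` close, according to the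
distance between `{i, j}` and `{k, l}`. -/
theorem sum_quadruple_le (hw : ∀ e, 0 ≤ w e) (hw' : w ⊤ = 0) (m : ℕ) :
    ∑ i, ∑ j, ∑ k, ∑ l, (if G.edist i j ≤ m ∧ G.edist k l ≤ m then
        w (min (min (G.edist i k) (G.edist i l)) (min (G.edist j k) (G.edist j l))) else 0)
      ≤ 4 * (n * ∑' s : ℕ, cNet G s m ((2 : ℕ) : ℝ) * w s) := by
  -- Here (i, k) is a closest cross pair. The four possible closest pairs are permutations of this
  -- case, whence the factor 4.
  set Q : Fin n → Fin n → Fin n → Fin n → ℝ := fun i j k l =>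
    if (G.edist i j ≤ m ∧ G.edist i k ≤ G.edist k j) ∧ (G.edist k l ≤ m ∧ G.edist i k ≤ G.edist i l)
      then w (G.edist i k) else 0 with hQ
  have hQnn : ∀ i j k l, 0 ≤ Q i j k l := by
    intro i j k l
    simp only [hQ]
    split_ifs
    · exact hw _
    · exact le_rfl
  have hpt : ∀ i j k l, (if G.edist i j ≤ m ∧ G.edist k l ≤ m then
        w (min (min (G.edist i k) (G.edist i l)) (min (G.edist j k) (G.edist j l))) else 0)
      ≤ Q i j k l + Q i j l k + Q j i k l + Q j i l k := by
    intro i j k l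
    by_cases hm : G.edist i j ≤ m ∧ G.edist k l ≤ m
    · rw [if_pos hm]
      obtain ⟨h1, h2⟩ := hm
      have h1' : G.edist j i ≤ m := by rwa [SimpleGraph.edist_comm]
      have h2' : G.edist l k ≤ m := by rwa [SimpleGraph.edist_comm]
      have c1 := SimpleGraph.edist_comm (G := G) (u := j) (v := k)
      have c2 := SimpleGraph.edist_comm (G := G) (u := j) (v := l)
      have c3 := SimpleGraph.edist_comm (G := G) (u := i) (v := k)
      have c4 := SimpleGraph.edist_comm (G := G) (u := i) (v := l)
      have n1 := hQnn i j k l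
      have n2 := hQnn i j l k
      have n3 := hQnn j i k l
      have n4 := hQnn j i l k
      set e := min (min (G.edist i k) (G.edist i l)) (min (G.edist j k) (G.edist j l)) with he
      have l1 : e ≤ G.edist i k := (min_le_left _ _).trans (min_le_left _ _)
      have l2 : e ≤ G.edist i l := (min_le_left _ _).trans (min_le_right _ _)
      have l3 : e ≤ G.edist j k := (min_le_right _ _).trans (min_le_left _ _)
      have l4 : e ≤ G.edist j l := (min_le_right _ _).trans (min_le_right _ _)
      have hcases : e = G.edist i k ∨ e = G.edist i l ∨ e = G.edist j k ∨ e = G.edist j l := by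
        rcases min_choice (min (G.edist i k) (G.edist i l)) (min (G.edist j k) (G.edist j l))
          with h | h
        · rcases min_choice (G.edist i k) (G.edist i l) with h' | h'
          · exact Or.inl (by rw [he, h, h'])
          · exact Or.inr (Or.inl (by rw [he, h, h']))
        · rcases min_choice (G.edist j k) (G.edist j l) with h' | h'
          · exact Or.inr (Or.inr (Or.inl (by rw [he, h, h'])))
          · exact Or.inr (Or.inr (Or.inr (by rw [he, h, h'])))
      rcases hcases with h | h | h | h
      · have : Q i j k l = w e := by
          simp only [hQ]
          rw [← h, if_pos ⟨⟨h1, c1 ▸ l3⟩, h2, l2⟩]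
        linarith
      · have : Q i j l k = w e := by
          simp only [hQ]
          rw [← h, if_pos ⟨⟨h1, c2 ▸ l4⟩, h2', l1⟩]
        linarith
      · have : Q j i k l = w e := by
          simp only [hQ]
          rw [← h, if_pos ⟨⟨h1', c3 ▸ l1⟩, h2, l4⟩]
        linarith
      · have : Q j i l k = w e := by
          simp only [hQ]
          rw [← h, if_pos ⟨⟨h1', c4 ▸ l2⟩, h2', l3⟩]
        linarith
    · rw [if_neg hm]
      linarith [hQnn i j k l, hQnn i j l k, hQnn j i k l, hQnn j i l k]
  set U : Fin n → Fin n → ℝ := fun i k => (shellMax G m i (G.edist i k).toNat : ℝ) with hU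
  -- Given (i, k), the choices of j and of l are independent and number at most U i k and U k i. The
  -- inequality xy ≤ (x² + y²)/2 turns the product into the second powers in c(s, m; 2).
  have hjl : ∀ i k, ∑ j, ∑ l, Q i j k l
      ≤ (w (G.edist i k) * U i k ^ 2 + w (G.edist k i) * U k i ^ 2) / 2 := by
    intro i k
    have hfac : ∑ j, ∑ l, Q i j k l = w (G.edist i k) *
        (((Finset.univ.filter fun j => G.edist i j ≤ m ∧ G.edist i k ≤ G.edist k j).card : ℝ) *
        ((Finset.univ.filter fun l => G.edist k l ≤ m ∧ G.edist i k ≤ G.edist i l).card : ℝ)) := by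
      rw [Finset.card_filter, Finset.card_filter, Nat.cast_sum, Nat.cast_sum, Finset.sum_mul_sum,
        Finset.mul_sum]
      refine Finset.sum_congr rfl fun j _ => ?_
      rw [Finset.mul_sum]
      refine Finset.sum_congr rfl fun l _ => ?_
      simp only [hQ, ite_and]
      split_ifs <;> simp
    rw [hfac]
    by_cases htop : G.edist i k = ⊤
    · rw [SimpleGraph.edist_comm (u := k)]
      simp [htop, hw']
    · obtain ⟨s, hs⟩ := ENat.ne_top_iff_exists.1 htop
      have hs' : G.edist k i = s := by rw [SimpleGraph.edist_comm, hs]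
      have hc1 : ((Finset.univ.filter fun j => G.edist i j ≤ m ∧ G.edist i k ≤ G.edist k j).card : ℝ)
          ≤ U i k := by
        simp only [hU]
        rw [← hs, ENat.toNat_natCast]
        exact Nat.cast_le.2 (card_le_shellMax G (k := k) hs.symm _
          fun j hj => (Finset.mem_filter.1 hj).2)
      have hc2 : ((Finset.univ.filter fun l => G.edist k l ≤ m ∧ G.edist i k ≤ G.edist i l).card : ℝ)
          ≤ U k i := by
        simp only [hU]
        rw [hs', ← hs, ENat.toNat_natCast]
        exact Nat.cast_le.2 (card_le_shellMax G (k := i) hs' _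
          fun j hj => (Finset.mem_filter.1 hj).2)
      have hU0 : 0 ≤ U i k := Nat.cast_nonneg _
      have hprod := mul_le_mul hc1 hc2 (Nat.cast_nonneg _) hU0
      rw [SimpleGraph.edist_comm (u := k)]
      nlinarith [mul_le_mul_of_nonneg_left hprod (hw (G.edist i k)),
        mul_nonneg (hw (G.edist i k)) (sq_nonneg (U i k - U k i))]
  have hsum : ∑ i, ∑ j, ∑ k, ∑ l, Q i j k l
      ≤ n * ∑' s : ℕ, cNet G s m ((2 : ℕ) : ℝ) * w s := by
    have h2 := sum_edist_le G hw hw' m 2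
    calc ∑ i, ∑ j, ∑ k, ∑ l, Q i j k l = ∑ i, ∑ k, ∑ j, ∑ l, Q i j k l :=
          Finset.sum_congr rfl fun i _ => Finset.sum_comm
      _ ≤ ∑ i, ∑ k, (w (G.edist i k) * U i k ^ 2 + w (G.edist k i) * U k i ^ 2) / 2 :=
          Finset.sum_le_sum fun i _ => Finset.sum_le_sum fun k _ => hjl i k
      _ = (∑ i, ∑ k, w (G.edist i k) * U i k ^ 2 + ∑ i, ∑ k, w (G.edist k i) * U k i ^ 2) / 2 := by
          simp only [← Finset.sum_div, Finset.sum_add_distrib]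
      _ = ∑ i, ∑ k, w (G.edist i k) * U i k ^ 2 := by
          rw [Finset.sum_comm (f := fun i k => w (G.edist k i) * U k i ^ 2)]; ring
      _ ≤ _ := h2
  calc _ ≤ ∑ i, ∑ j, ∑ k, ∑ l, (Q i j k l + Q i j l k + Q j i k l + Q j i l k) :=
        Finset.sum_le_sum fun i _ => Finset.sum_le_sum fun j _ => Finset.sum_le_sum fun k _ =>
          Finset.sum_le_sum fun l _ => hpt i j k l
    _ = ∑ i, ∑ j, ∑ k, ∑ l, Q i j k l + ∑ i, ∑ j, ∑ k, ∑ l, Q i j l k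
        + ∑ i, ∑ j, ∑ k, ∑ l, Q j i k l + ∑ i, ∑ j, ∑ k, ∑ l, Q j i l k := by
        simp only [Finset.sum_add_distrib]
    _ = 4 * ∑ i, ∑ j, ∑ k, ∑ l, Q i j k l := by
        have e1 : ∑ i, ∑ j, ∑ k, ∑ l, Q i j l k = ∑ i, ∑ j, ∑ k, ∑ l, Q i j k l :=
          Finset.sum_congr rfl fun i _ => Finset.sum_congr rfl fun j _ => Finset.sum_comm
        have e2 : ∑ i, ∑ j, ∑ k, ∑ l, Q j i k l = ∑ i, ∑ j, ∑ k, ∑ l, Q i j k l :=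
          Finset.sum_comm
        have e3 : ∑ i, ∑ j, ∑ k, ∑ l, Q j i l k = ∑ i, ∑ j, ∑ k, ∑ l, Q i j k l :=
          Finset.sum_comm.trans e1
        rw [e1, e2, e3]; ring
    _ ≤ _ := by linarith

end Counting

/-! ### Covariances of variables with moments, by truncation -/

section Truncation

variable {α : Type*} [MeasurableSpace α] {Q : Measure α}

theorem integrable_of_abs_le_pow {R : α → ℝ} {p M : ℝ} {r : ℕ} (hr : (r : ℝ) ≤ p)
    (hR : ∀ x, 1 ≤ R x) (hint : Integrable (fun x => R x ^ p) Q) (hM : ∫ x, R x ^ p ∂Q ≤ M)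
    {f : α → ℝ} (hf : AEStronglyMeasurable f Q) (hle : ∀ x, |f x| ≤ R x ^ r) :
    Integrable f Q ∧ |∫ x, f x ∂Q| ≤ M := by
  have hle' : ∀ x, |f x| ≤ R x ^ p := fun x =>
    (hle x).trans (by rw [← Real.rpow_natCast]; exact Real.rpow_le_rpow_of_exponent_le (hR x) hr)
  have h1 : Integrable f Q := hint.mono' hf (ae_of_all _ hle')
  exact ⟨h1, (abs_integral_le_integral_abs).trans ((integral_mono h1.abs hint hle').trans hM)⟩

/-- The truncated variables differ from the original ones only where R > T, and there R^{a+b} ≤ R^p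
T^{a+b-p}. Each of the three expectations thus changes by at most 2M T^{a+b-p}; since M ≥ 1, the
total is covered by 6M². -/
theorem abs_cov_sub_cov_truncation_le [IsProbabilityMeasure Q] {U V U' V' R : α → ℝ} {a b : ℕ} {p M T : ℝ}
    (hp : (a : ℝ) + b < p) (hT : 1 ≤ T) (hR : ∀ x, 1 ≤ R x)
    (hint : Integrable (fun x => R x ^ p) Q) (hM : ∫ x, R x ^ p ∂Q ≤ M)
    (hU : AEStronglyMeasurable U Q) (hV : AEStronglyMeasurable V Q)
    (hU' : AEStronglyMeasurable U' Q) (hV' : AEStronglyMeasurable V' Q)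
    (bU : ∀ x, |U x| ≤ R x ^ a) (bV : ∀ x, |V x| ≤ R x ^ b)
    (bU' : ∀ x, |U' x| ≤ R x ^ a) (bV' : ∀ x, |V' x| ≤ R x ^ b)
    (eU : ∀ x, R x ≤ T → U' x = U x) (eV : ∀ x, R x ≤ T → V' x = V x) :
    |(∫ x, U x * V x ∂Q - (∫ x, U x ∂Q) * ∫ x, V x ∂Q)
      - (∫ x, U' x * V' x ∂Q - (∫ x, U' x ∂Q) * ∫ x, V' x ∂Q)|
      ≤ 6 * M ^ 2 * T ^ ((a : ℝ) + b - p) := by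
  have ha : (a : ℝ) ≤ p := by have : (0 : ℝ) ≤ b := Nat.cast_nonneg _; linarith
  have hb : (b : ℝ) ≤ p := by have : (0 : ℝ) ≤ a := Nat.cast_nonneg _; linarith
  have hab : ((a + b : ℕ) : ℝ) ≤ p := by push_cast; exact hp.le
  have hp0 : 0 ≤ p := (Nat.cast_nonneg a).trans ha
  have hM1 : 1 ≤ M := by
    refine le_trans ?_ hM
    calc (1 : ℝ) = ∫ _x, (1 : ℝ) ∂Q := by simp
      _ ≤ _ := integral_mono (integrable_const _) hint fun x => Real.one_le_rpow (hR x) hp0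
  have prod_le : ∀ {f g : α → ℝ}, (∀ x, |f x| ≤ R x ^ a) → (∀ x, |g x| ≤ R x ^ b) →
      ∀ x, |f x * g x| ≤ R x ^ (a + b) := by
    intro f g hf hg x
    rw [abs_mul, pow_add]
    exact mul_le_mul (hf x) (hg x) (abs_nonneg _) (by have := hR x; positivity)
  set q := T ^ ((a : ℝ) + b - p) with hq
  have hq0 : 0 ≤ q := by positivity
  have tail : ∀ x, T < R x → R x ^ (a + b) ≤ R x ^ p * q := by
    intro x hx
    have hx0 : 0 < R x := by linarith [hR x]
    have : R x ^ (a + b) = R x ^ p * R x ^ ((a : ℝ) + b - p) := by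
      rw [← Real.rpow_add hx0, ← Real.rpow_natCast]
      congr 1; push_cast; ring
    rw [this]
    exact mul_le_mul_of_nonneg_left
      (Real.rpow_le_rpow_of_nonpos (by linarith) hx.le (by linarith)) (by positivity)
  have diff : ∀ {f g : α → ℝ}, AEStronglyMeasurable f Q → AEStronglyMeasurable g Q →
      (∀ x, |f x| ≤ R x ^ (a + b)) → (∀ x, |g x| ≤ R x ^ (a + b)) →
      (∀ x, R x ≤ T → g x = f x) → |∫ x, f x ∂Q - ∫ x, g x ∂Q| ≤ 2 * M * q := by
    intro f g hf hg bf bg e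
    have If := (integrable_of_abs_le_pow hab hR hint hM hf bf).1
    have Ig := (integrable_of_abs_le_pow hab hR hint hM hg bg).1
    rw [← integral_sub If Ig]
    refine (abs_integral_le_integral_abs).trans ?_
    calc ∫ x, |f x - g x| ∂Q ≤ ∫ x, 2 * q * R x ^ p ∂Q := by
          refine integral_mono (If.sub Ig).abs (hint.const_mul _) fun x => ?_
          rcases le_or_gt (R x) T with h | h
          · have h0 : 0 ≤ 2 * q * R x ^ p := by have := hR x; positivity
            simpa [e x h] using h0
          · calc |f x - g x| ≤ |f x| + |g x| := abs_sub _ _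
              _ ≤ R x ^ (a + b) + R x ^ (a + b) := add_le_add (bf x) (bg x)
              _ ≤ _ := by linarith [tail x h]
      _ = 2 * q * ∫ x, R x ^ p ∂Q := integral_const_mul _ _
      _ ≤ 2 * q * M := mul_le_mul_of_nonneg_left hM (by positivity)
      _ = _ := by ring
  have up : ∀ {f : α → ℝ} {c : ℕ}, c ≤ a + b → (∀ x, |f x| ≤ R x ^ c) →
      ∀ x, |f x| ≤ R x ^ (a + b) :=
    fun hc hf x => (hf x).trans (pow_le_pow_right₀ (hR x) hc)
  have d1 := diff (hU.mul hV) (hU'.mul hV') (prod_le bU bV) (prod_le bU' bV')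
    fun x hx => by simp only [Pi.mul_apply, eU x hx, eV x hx]
  have d2 := diff hU hU' (up (by omega) bU) (up (by omega) bU') eU
  have d3 := diff hV hV' (up (by omega) bV) (up (by omega) bV') eV
  have b2 := (integrable_of_abs_le_pow hb hR hint hM hV bV).2
  have b3 := (integrable_of_abs_le_pow ha hR hint hM hU' bU').2
  simp only [Pi.mul_apply] at d1
  set x1 := ∫ x, U x * V x ∂Q
  set x2 := ∫ x, U' x * V' x ∂Q
  set u := ∫ x, U x ∂Q
  set u' := ∫ x, U' x ∂Q
  set v := ∫ x, V x ∂Q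
  set v' := ∫ x, V' x ∂Q
  have e : (x1 - u * v) - (x2 - u' * v') = (x1 - x2) - (u - u') * v - u' * (v - v') := by ring
  rw [e]
  calc |(x1 - x2) - (u - u') * v - u' * (v - v')|
      ≤ |x1 - x2| + |u - u'| * |v| + |u'| * |v - v'| := by
        rw [← abs_mul, ← abs_mul]
        exact (abs_sub _ _).trans (add_le_add (abs_sub _ _) le_rfl)
    _ ≤ 2 * M * q + (2 * M * q) * M + M * (2 * M * q) := by
        gcongr
    _ ≤ _ := by nlinarith [mul_nonneg hq0 (by linarith : 0 ≤ M)]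

/-- The terms T^r θ and T^{r-p} balance at T = θ^{-1/p}. Rounding up to a natural number costs at
most 2^r. For θ ≥ 1 the level T = 1 suffices, and for θ = 0 one lets T → ∞. -/
theorem le_rpow_of_forall_truncation {x A B θ Θ p : ℝ} {r : ℕ} (hp : 0 < p) (hr : (r : ℝ) < p)
    (hA : 0 ≤ A) (hB : 0 ≤ B) (hθ : 0 ≤ θ) (hθΘ : θ ≤ Θ) (hΘ : 1 ≤ Θ)
    (h : ∀ T : ℕ, 1 ≤ T → x ≤ B * (T : ℝ) ^ r * θ + A * (T : ℝ) ^ ((r : ℝ) - p)) :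
    x ≤ 2 ^ r * (B * Θ + A) * θ ^ (1 - r / p) := by
  have hq : 0 < 1 - r / p := by rw [sub_pos, div_lt_one hp]; exact hr
  have h2 : (1 : ℝ) ≤ 2 ^ r := one_le_pow₀ (by norm_num)
  have hBA : 0 ≤ B * Θ + A := by positivity
  rcases hθ.eq_or_lt with rfl | hθ0
  · rw [Real.zero_rpow hq.ne', mul_zero]
    have ht : Tendsto (fun T : ℕ => A * (T : ℝ) ^ ((r : ℝ) - p)) atTop (𝓝 (A * 0)) := by
      refine Tendsto.const_mul _ ?_
      have := (tendsto_rpow_neg_atTop (sub_pos.2 hr)).comp tendsto_natCast_atTop_atTop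
      simpa [Function.comp_def] using this
    rw [mul_zero] at ht
    refine ge_of_tendsto ht (eventually_atTop.2 ⟨1, fun T hT => ?_⟩)
    simpa using h T hT
  · rcases le_or_gt 1 θ with h1 | h1
    · have hx := h 1 le_rfl
      simp only [Nat.cast_one, one_pow, mul_one, Real.one_rpow] at hx
      have h3 : 1 ≤ θ ^ (1 - r / p) := Real.one_le_rpow h1 hq.le
      calc x ≤ B * Θ + A := by nlinarith
        _ = 1 * (B * Θ + A) * 1 := by ring
        _ ≤ _ := by gcongr
    · set t := θ ^ (-(1 / p)) with ht
      have ht1 : 1 ≤ t := Real.one_le_rpow_of_pos_of_le_one_of_nonpos hθ0 h1.le (by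
        have : 0 < 1 / p := by positivity
        linarith)
      have hT1 : 1 ≤ ⌈t⌉₊ := Nat.one_le_ceil_iff.2 (by linarith)
      have hTt : t ≤ (⌈t⌉₊ : ℝ) := Nat.le_ceil _
      have hT2 : (⌈t⌉₊ : ℝ) ≤ 2 * t := by linarith [Nat.ceil_lt_add_one (by linarith : 0 ≤ t)]
      have hx := h _ hT1
      have e1 : t ^ r * θ = θ ^ (1 - r / p) := by
        rw [ht, ← Real.rpow_natCast, ← Real.rpow_mul hθ]
        nth_rewrite 2 [← Real.rpow_one θ]
        rw [← Real.rpow_add hθ0]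
        congr 1; ring
      have e2 : t ^ ((r : ℝ) - p) = θ ^ (1 - r / p) := by
        rw [ht, ← Real.rpow_mul hθ]
        congr 1; field_simp; ring
      have i1 : B * (⌈t⌉₊ : ℝ) ^ r * θ ≤ 2 ^ r * B * θ ^ (1 - r / p) := by
        calc B * (⌈t⌉₊ : ℝ) ^ r * θ ≤ B * (2 * t) ^ r * θ := by gcongr
          _ = 2 ^ r * B * (t ^ r * θ) := by rw [mul_pow]; ring
          _ = _ := by rw [e1]
      have i2 : A * (⌈t⌉₊ : ℝ) ^ ((r : ℝ) - p) ≤ A * θ ^ (1 - r / p) := by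
        rw [← e2]
        exact mul_le_mul_of_nonneg_left
          (Real.rpow_le_rpow_of_nonpos (by linarith) hTt (by linarith)) hA
      set z := θ ^ (1 - r / p)
      have hz : 0 ≤ z := by positivity
      calc x ≤ 2 ^ r * B * z + A * z := by linarith
        _ ≤ 2 ^ r * (B * Θ) * z + 2 ^ r * A * z := by
            gcongr
            · nlinarith
            · nlinarith
        _ = _ := by ring

end Truncation

/-! ### Deterministic form of the assumptions -/

section Law

/-- `x` truncated at the levels `± T`. -/
noncomputable def clip (T x : ℝ) : ℝ := max (-T) (min x T)

theorem abs_clip_le {T : ℝ} (hT : 0 ≤ T) (x : ℝ) : |clip T x| ≤ T :=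
  abs_le.2 ⟨le_max_left _ _, max_le (by linarith) (min_le_right _ _)⟩

theorem clip_eq_self {T x : ℝ} (h : |x| ≤ T) : clip T x = x := by
  rw [abs_le] at h
  rw [clip, min_eq_left h.2, max_eq_right h.1]

theorem abs_clip_le_abs {T : ℝ} (hT : 0 ≤ T) (x : ℝ) : |clip T x| ≤ |x| := by
  rcases le_total |x| T with h | h
  · rw [clip_eq_self h]
  · exact (abs_clip_le hT x).trans h

theorem abs_clip_sub_le (T x y : ℝ) : |clip T x - clip T y| ≤ |x - y| := by
  unfold clip
  have h1 := abs_max_sub_max_le_abs (min x T) (min y T) (-T)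
  have h2 := abs_min_sub_min_le_max x T y T
  rw [sub_self, abs_zero, max_eq_left (abs_nonneg _)] at h2
  rw [max_comm (-T), max_comm (-T)]
  exact h1.trans h2

theorem continuous_clip (T : ℝ) : Continuous (clip T) := by
  unfold clip; fun_prop

/-- The test functions to which `ψ`-dependence is applied. -/
def testFun (n : ℕ) : Set ((Fin n → ℝ) → ℝ) :=
  (Set.range fun q : ℕ × Fin n => fun y => clip q.1 (y q.2)) ∪
  (Set.range fun q : ℕ × Fin n × Fin n => fun y => clip q.1 (y q.2.1) * clip q.1 (y q.2.2)) ∪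
  (Set.range fun q : ℕ × Fin n × Fin n => fun y => |clip q.1 (y q.2.1)| * clip q.1 (y q.2.2)) ∪
  (Set.range fun q : ℚ × Finset (Fin n) => fun y => Real.cos (q.1 * ∑ j ∈ q.2, y j + 0)) ∪
  (Set.range fun q : ℚ × Finset (Fin n) => fun y => Real.cos (q.1 * ∑ j ∈ q.2, y j
    + -(Real.pi / 2)))

/-- The reason for natural truncation levels and rational frequencies: conditional ψ-dependence has
an exceptional null set for each pair of test functions. -/
theorem countable_testFun (n : ℕ) : (testFun n).Countable :=
  ((((Set.countable_range _).union (Set.countable_range _)).union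
    (Set.countable_range _)).union (Set.countable_range _)).union (Set.countable_range _)

/-- `F` is bounded by `M`, depends on the coordinates in `A` only, and is `L`-Lipschitz. -/
structure IsBddLipOn {n : ℕ} (F : (Fin n → ℝ) → ℝ) (A : Finset (Fin n)) (M L : ℝ) : Prop where
  abs_le : ∀ x, |F x| ≤ M
  lip_nonneg : 0 ≤ L
  abs_sub_le : ∀ x y, |F x - F y| ≤ L * ∑ i ∈ A, |x i - y i|

/-- A law on `ℝ^n` with bounded moments and `ψ`-dependence along the network `G`. -/
structure PsiDependentLaw {n : ℕ} (Q : Measure (Fin n → ℝ)) (G : SimpleGraph (Fin n))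
    (θ : ℕ → ℝ) (p K M Θ : ℝ) : Prop where
  four_lt : 4 < p
  K_nonneg : 0 ≤ K
  one_le_Theta : 1 ≤ Θ
  integrable_rpow : ∀ i, Integrable (fun y : Fin n → ℝ => |y i| ^ p) Q
  integral_rpow_le : ∀ i, ∫ y : Fin n → ℝ, |y i| ^ p ∂Q ≤ M
  integral_eq_zero : ∀ i, ∫ y : Fin n → ℝ, y i ∂Q = 0
  theta_nonneg : ∀ s, 0 ≤ θ s
  theta_zero : θ 0 = 1
  theta_le : ∀ s, θ s ≤ Θ
  connected_or : G.Preconnected ∨ Tendsto θ atTop (𝓝 0)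
  cov_le : ∀ F ∈ testFun n, ∀ H ∈ testFun n, ∀ A B : Finset (Fin n), A.Nonempty → B.Nonempty →
    ∀ a b a' b' : ℝ, IsBddLipOn F A a b → IsBddLipOn H B a' b' → ∀ s : ℕ, 0 < s →
      (∀ i ∈ A, ∀ j ∈ B, (s : ℕ∞) ≤ G.edist i j) →
      |∫ y, F y * H y ∂Q - (∫ y, F y ∂Q) * ∫ y, H y ∂Q|
        ≤ K * ((A.card : ℝ) * B.card) * (a + b) * (a' + b') * θ s

/-- `θ` as a function of the extended distance, vanishing at `⊤`. -/
noncomputable def thetaAt (θ : ℕ → ℝ) (e : ℕ∞) : ℝ := if e = ⊤ then 0 else θ e.toNat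

theorem thetaAt_top (θ : ℕ → ℝ) : thetaAt θ ⊤ = 0 := if_pos rfl

theorem thetaAt_coe (θ : ℕ → ℝ) (s : ℕ) : thetaAt θ s = θ s := by
  rw [thetaAt, if_neg (ENat.natCast_ne_top s), ENat.toNat_natCast]

theorem thetaAt_nonneg {θ : ℕ → ℝ} (h : ∀ s, 0 ≤ θ s) (e : ℕ∞) : 0 ≤ thetaAt θ e := by
  unfold thetaAt
  split_ifs
  · exact le_rfl
  · exact h _

variable {n : ℕ} {Q : Measure (Fin n → ℝ)} {G : SimpleGraph (Fin n)}
  {θ : ℕ → ℝ} {p K M Θ : ℝ}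

/-- An envelope for four coordinates. -/
def envelope (i j k l : Fin n) (y : Fin n → ℝ) : ℝ :=
  max 1 (max (max |y i| |y j|) (max |y k| |y l|))

theorem one_le_envelope (i j k l : Fin n) (y : Fin n → ℝ) : 1 ≤ envelope i j k l y :=
  le_max_left _ _

theorem abs_le_envelope (i j k l : Fin n) (y : Fin n → ℝ) :
    |y i| ≤ envelope i j k l y ∧ |y j| ≤ envelope i j k l y ∧ |y k| ≤ envelope i j k l y
      ∧ |y l| ≤ envelope i j k l y := by
  unfold envelope
  simp

theorem continuous_envelope (i j k l : Fin n) : Continuous (envelope i j k l) := by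
  unfold envelope; fun_prop

namespace PsiDependentLaw

variable [IsProbabilityMeasure Q]

theorem envelope_rpow (h : PsiDependentLaw Q G θ p K M Θ) (i j k l : Fin n) :
    Integrable (fun y => envelope i j k l y ^ p) Q
      ∧ ∫ y, envelope i j k l y ^ p ∂Q ≤ 1 + 4 * M := by
  have hp : 0 ≤ p := by linarith [h.four_lt]
  have hle : ∀ y, envelope i j k l y ^ p
      ≤ 1 + (|y i| ^ p + |y j| ^ p + |y k| ^ p + |y l| ^ p) := by
    intro y
    have hi : 0 ≤ |y i| ^ p := by positivity
    have hj : 0 ≤ |y j| ^ p := by positivity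
    have hk : 0 ≤ |y k| ^ p := by positivity
    have hl : 0 ≤ |y l| ^ p := by positivity
    unfold envelope
    rcases max_choice 1 (max (max |y i| |y j|) (max |y k| |y l|)) with e | e <;> rw [e]
    · rw [Real.one_rpow]; linarith
    · rcases max_choice (max |y i| |y j|) (max |y k| |y l|) with e | e <;> rw [e]
      · rcases max_choice |y i| |y j| with e | e <;> rw [e] <;> linarith
      · rcases max_choice |y k| |y l| with e | e <;> rw [e] <;> linarith
  have hI : Integrable (fun y : Fin n → ℝ =>
      1 + (|y i| ^ p + |y j| ^ p + |y k| ^ p + |y l| ^ p)) Q :=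
    (integrable_const _).add ((((h.integrable_rpow i).add (h.integrable_rpow j)).add
      (h.integrable_rpow k)).add (h.integrable_rpow l))
  have hR : Integrable (fun y => envelope i j k l y ^ p) Q := by
    refine hI.mono' ?_ (ae_of_all _ fun y => ?_)
    · exact ((continuous_envelope i j k l).rpow_const fun y => Or.inr hp).aestronglyMeasurable
    · have := one_le_envelope i j k l y
      rw [Real.norm_of_nonneg (by positivity)]
      exact hle y
  refine ⟨hR, (integral_mono hR hI hle).trans ?_⟩
  have hi := h.integrable_rpow i
  have hj := h.integrable_rpow j
  have hk := h.integrable_rpow k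
  have hl := h.integrable_rpow l
  rw [integral_add (integrable_const _) (by fun_prop), integral_add (by fun_prop) (by fun_prop),
    integral_add (by fun_prop) (by fun_prop), integral_add (by fun_prop) (by fun_prop)]
  simp only [integral_const, probReal_univ, one_smul]
  linarith [h.integral_rpow_le i, h.integral_rpow_le j, h.integral_rpow_le k,
    h.integral_rpow_le l]

theorem integrable_of_abs_le (h : PsiDependentLaw Q G θ p K M Θ) (i j k l : Fin n)
    {f : (Fin n → ℝ) → ℝ} (hf : AEStronglyMeasurable f Q)
    (hle : ∀ y, |f y| ≤ envelope i j k l y ^ 4) : Integrable f Q ∧ |∫ y, f y ∂Q| ≤ 1 + 4 * M :=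
  integrable_of_abs_le_pow (r := 4) (by exact_mod_cast h.four_lt.le)
    (one_le_envelope i j k l) (h.envelope_rpow i j k l).1 (h.envelope_rpow i j k l).2 hf hle

/-- The general covariance inequality. -/
theorem abs_cov_le (h : PsiDependentLaw Q G θ p K M Θ) (i j k l : Fin n) {a b : ℕ}
    (hab : a + b ≤ 4) {A B : Finset (Fin n)} (hA : A.Nonempty) (hB : B.Nonempty)
    {U V : (Fin n → ℝ) → ℝ} {U' V' : ℕ → (Fin n → ℝ) → ℝ} {α β : ℝ} (hα : 0 ≤ α) (hβ : 0 ≤ β)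
    (hU : Continuous U) (hV : Continuous V) (hU' : ∀ T, Continuous (U' T))
    (hV' : ∀ T, Continuous (V' T))
    (bU : ∀ y, |U y| ≤ envelope i j k l y ^ a) (bV : ∀ y, |V y| ≤ envelope i j k l y ^ b)
    (bU' : ∀ T y, |U' T y| ≤ envelope i j k l y ^ a)
    (bV' : ∀ T y, |V' T y| ≤ envelope i j k l y ^ b)
    (eU : ∀ (T : ℕ) y, envelope i j k l y ≤ T → U' T y = U y)
    (eV : ∀ (T : ℕ) y, envelope i j k l y ≤ T → V' T y = V y)
    (tU : ∀ T, U' T ∈ testFun n) (tV : ∀ T, V' T ∈ testFun n)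
    (lU : ∀ T : ℕ, 1 ≤ T → IsBddLipOn (U' T) A ((T : ℝ) ^ a) (α * (T : ℝ) ^ a))
    (lV : ∀ T : ℕ, 1 ≤ T → IsBddLipOn (V' T) B ((T : ℝ) ^ b) (β * (T : ℝ) ^ b))
    {e : ℕ∞} (he : ∀ x ∈ A, ∀ y ∈ B, e ≤ G.edist x y) :
    |∫ y, U y * V y ∂Q - (∫ y, U y ∂Q) * ∫ y, V y ∂Q|
      ≤ 2 ^ (a + b) * (K * ((A.card : ℝ) * B.card) * (1 + α) * (1 + β) * Θ + 6 * (1 + 4 * M) ^ 2)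
        * thetaAt θ e ^ (1 - ((a + b : ℕ) : ℝ) / p) := by
  have hp := h.four_lt
  have hp0 : 0 < p := by linarith
  have hab' : ((a + b : ℕ) : ℝ) ≤ 4 := by exact_mod_cast hab
  have habp : ((a + b : ℕ) : ℝ) < p := by linarith
  have habp' : (a : ℝ) + b < p := by push_cast at habp; exact habp
  obtain ⟨hRint, hRM⟩ := h.envelope_rpow i j k l
  set D := K * ((A.card : ℝ) * B.card) * (1 + α) * (1 + β) with hD
  have hD0 : 0 ≤ D := by have := h.K_nonneg; positivity
  have hΘ := h.one_le_Theta
  have hC : 0 ≤ D * Θ + 6 * (1 + 4 * M) ^ 2 := by positivity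
  set x := |∫ y, U y * V y ∂Q - (∫ y, U y ∂Q) * ∫ y, V y ∂Q| with hx
  -- Any positive s below the distance may be used, not only the distance itself; this is needed for
  -- infinite e.
  have fin : ∀ s : ℕ, 0 < s → (s : ℕ∞) ≤ e →
      x ≤ 2 ^ (a + b) * (D * Θ + 6 * (1 + 4 * M) ^ 2) * θ s ^ (1 - ((a + b : ℕ) : ℝ) / p) := by
    intro s hs hse
    refine le_rpow_of_forall_truncation hp0 habp (by positivity) hD0 (h.theta_nonneg s)
      (h.theta_le s) hΘ fun T hT => ?_
    have h1 := h.cov_le _ (tU T) _ (tV T) A B hA hB _ _ _ _ (lU T hT) (lV T hT) s hs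
      fun x hx y hy => hse.trans (he x hx y hy)
    have h2 := abs_cov_sub_cov_truncation_le (T := T) habp' (by exact_mod_cast hT)
      (one_le_envelope i j k l) hRint hRM hU.aestronglyMeasurable hV.aestronglyMeasurable
      (hU' T).aestronglyMeasurable (hV' T).aestronglyMeasurable bU bV (bU' T) (bV' T) (eU T) (eV T)
    have h3 := abs_sub_abs_le_abs_sub (∫ y, U y * V y ∂Q - (∫ y, U y ∂Q) * ∫ y, V y ∂Q)
      (∫ y, U' T y * V' T y ∂Q - (∫ y, U' T y ∂Q) * ∫ y, V' T y ∂Q)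
    have e1 : K * ((A.card : ℝ) * B.card) * ((T : ℝ) ^ a + α * (T : ℝ) ^ a)
        * ((T : ℝ) ^ b + β * (T : ℝ) ^ b) * θ s = D * (T : ℝ) ^ (a + b) * θ s := by
      rw [hD, pow_add]; ring
    push_cast
    rw [e1] at h1
    linarith
  -- At infinite distance the graph is not connected, so θ tends to 0 and the bound at s → ∞ shows
  -- that the covariance vanishes.
  rcases eq_or_ne e ⊤ with rfl | hetop
  · have hnc : ¬ G.Preconnected := by
      obtain ⟨u, hu⟩ := hA
      obtain ⟨v, hv⟩ := hB
      intro hcon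
      exact (SimpleGraph.edist_ne_top_iff_reachable.2 (hcon u v)) (top_le_iff.1 (he u hu v hv))
    have hθ := h.connected_or.resolve_left hnc
    have hq : 0 < 1 - ((a + b : ℕ) : ℝ) / p := by rw [sub_pos, div_lt_one hp0]; exact habp
    rw [thetaAt_top]
    refine ge_of_tendsto ((hθ.rpow_const (Or.inr hq.le)).const_mul _)
      (eventually_atTop.2 ⟨1, fun s hs => fin s hs le_top⟩)
  · obtain ⟨s, rfl⟩ := ENat.ne_top_iff_exists.1 hetop
    rw [thetaAt_coe]
    -- At distance 0 dependence says nothing; the moments bound the covariance, and θ_0 = 1.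
    rcases Nat.eq_zero_or_pos s with rfl | hs
    · rw [h.theta_zero, Real.one_rpow, mul_one]
      have hle : ∀ {f : (Fin n → ℝ) → ℝ} {c : ℕ}, c ≤ 4 → Continuous f →
          (∀ y, |f y| ≤ envelope i j k l y ^ c) → |∫ y, f y ∂Q| ≤ 1 + 4 * M := fun hc hf hb =>
        (h.integrable_of_abs_le i j k l hf.aestronglyMeasurable fun y =>
          (hb y).trans (pow_le_pow_right₀ (one_le_envelope i j k l y) hc)).2
      have b1 := hle (f := fun y => U y * V y) hab (hU.mul hV) fun y => by
        rw [abs_mul, pow_add]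
        exact mul_le_mul (bU y) (bV y) (abs_nonneg _)
          (by have := one_le_envelope i j k l y; positivity)
      have b2 := hle (by omega) hU bU
      have b3 := hle (by omega) hV bV
      have hM1 : 1 ≤ 1 + 4 * M := by
        have := hle (f := fun _ => 1) (c := 0) (by omega) continuous_const (by simp)
        simpa using this
      have h2 : (1 : ℝ) ≤ 2 ^ (a + b) := one_le_pow₀ (by norm_num)
      calc x ≤ |∫ y, U y * V y ∂Q| + |∫ y, U y ∂Q| * |∫ y, V y ∂Q| := by
            rw [hx, ← abs_mul]; exact abs_sub _ _
        _ ≤ (1 + 4 * M) + (1 + 4 * M) * (1 + 4 * M) := by gcongr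
        _ ≤ 1 * (D * Θ + 6 * (1 + 4 * M) ^ 2) := by nlinarith [mul_nonneg hD0 (by linarith : 0 ≤ Θ)]
        _ ≤ _ := by gcongr
    · exact fin s hs le_rfl

end PsiDependentLaw

end Law

/-! ### Covariance bounds for products and cosines -/

section Instances

variable {n : ℕ} {A : Finset (Fin n)}

theorem IsBddLipOn.mul {F H : (Fin n → ℝ) → ℝ} {a b a' b' : ℝ} (ha : 0 ≤ a) (ha' : 0 ≤ a')
    (hF : IsBddLipOn F A a b) (hH : IsBddLipOn H A a' b') :
    IsBddLipOn (fun y => F y * H y) A (a * a') (a * b' + b * a') where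
  abs_le x := by
    rw [abs_mul]
    exact mul_le_mul (hF.abs_le x) (hH.abs_le x) (abs_nonneg _) ha
  lip_nonneg := by have := hF.lip_nonneg; have := hH.lip_nonneg; positivity
  abs_sub_le x y := by
    have e : F x * H x - F y * H y = F x * (H x - H y) + (F x - F y) * H y := by ring
    rw [e]
    refine (abs_add_le _ _).trans ?_
    rw [abs_mul, abs_mul, add_mul, mul_assoc, mul_right_comm]
    have := hF.lip_nonneg
    have := hH.lip_nonneg
    exact add_le_add (mul_le_mul (hF.abs_le x) (hH.abs_sub_le x y) (abs_nonneg _) ha)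
      (mul_le_mul (hF.abs_sub_le x y) (hH.abs_le y) (abs_nonneg _) (by positivity))

theorem IsBddLipOn.abs {F : (Fin n → ℝ) → ℝ} {a b : ℝ} (hF : IsBddLipOn F A a b) :
    IsBddLipOn (fun y => |F y|) A a b where
  abs_le x := by rw [abs_abs]; exact hF.abs_le x
  lip_nonneg := hF.lip_nonneg
  abs_sub_le x y := (abs_abs_sub_abs_le _ _).trans (hF.abs_sub_le x y)

theorem isBddLipOn_clip {T : ℝ} (hT : 1 ≤ T) {i : Fin n} (hi : i ∈ A) :
    IsBddLipOn (fun y => clip T (y i)) A T T where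
  abs_le x := abs_clip_le (by linarith) _
  lip_nonneg := by linarith
  abs_sub_le x y := by
    refine (abs_clip_sub_le T _ _).trans ?_
    have h1 := Finset.single_le_sum (f := fun i => |x i - y i|) (fun i _ => abs_nonneg _) hi
    have h2 : 0 ≤ |x i - y i| := abs_nonneg _
    calc |x i - y i| ≤ 1 * ∑ i ∈ A, |x i - y i| := by rw [one_mul]; exact h1
      _ ≤ _ := by gcongr

theorem isBddLipOn_cos (u c : ℝ) :
    IsBddLipOn (fun y : Fin n → ℝ => Real.cos (u * ∑ j ∈ A, y j + c)) A 1 |u| where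
  abs_le x := Real.abs_cos_le_one _
  lip_nonneg := abs_nonneg _
  abs_sub_le x y := by
    have h1 := Real.abs_cos_sub_cos_le (u * ∑ j ∈ A, x j + c) (u * ∑ j ∈ A, y j + c)
    have e : u * ∑ j ∈ A, x j + c - (u * ∑ j ∈ A, y j + c) = u * ∑ j ∈ A, (x j - y j) := by
      rw [Finset.sum_sub_distrib]; ring
    rw [e, abs_mul] at h1
    exact h1.trans (mul_le_mul_of_nonneg_left (Finset.abs_sum_le_sum_abs _ _) (abs_nonneg _))

end Instances

namespace PsiDependentLaw

variable {n : ℕ} {Q : Measure (Fin n → ℝ)} {G : SimpleGraph (Fin n)}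
  {θ : ℕ → ℝ} {p K M Θ : ℝ}

/-- The constant in the covariance inequalities. -/
def covConst (K M Θ : ℝ) : ℝ := 16 * (36 * K * Θ + 6 * (1 + 4 * M) ^ 2)

theorem covConst_nonneg (h : PsiDependentLaw Q G θ p K M Θ) : 0 ≤ covConst K M Θ := by
  have := h.K_nonneg
  have := h.one_le_Theta
  unfold covConst
  positivity

/-- The worst case is two pairs of nodes: cardinalities 2 · 2, Lipschitz factors (1 + 2)(1 + 2), and
2^4 from the truncation. -/
theorem le_covConst (h : PsiDependentLaw Q G θ p K M Θ) {r : ℕ} (hr : r ≤ 4) {x : ℝ}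
    (hx : x ≤ 36) : 2 ^ r * (K * x * Θ + 6 * (1 + 4 * M) ^ 2) ≤ covConst K M Θ := by
  have hK := h.K_nonneg
  have hΘ := h.one_le_Theta
  have h2 : (2 : ℝ) ^ r ≤ 16 :=
    (pow_le_pow_right₀ (by norm_num : (1 : ℝ) ≤ 2) hr).trans (by norm_num)
  have h3 : K * x * Θ ≤ 36 * K * Θ := by
    have : K * x ≤ 36 * K := by nlinarith
    gcongr
  have h4 : 0 ≤ 36 * K * Θ + 6 * (1 + 4 * M) ^ 2 := by positivity
  unfold covConst
  calc _ ≤ (2 : ℝ) ^ r * (36 * K * Θ + 6 * (1 + 4 * M) ^ 2) := by gcongr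
    _ ≤ _ := by gcongr

variable [IsProbabilityMeasure Q]

/-- The lower bound e is left free because θ is not assumed monotone: for distant nodes both the
exact distance and m are used. -/
theorem abs_integral_mul_le (h : PsiDependentLaw Q G θ p K M Θ) (i j : Fin n) {e : ℕ∞}
    (he : e ≤ G.edist i j) :
    |∫ y, y i * y j ∂Q| ≤ covConst K M Θ * thetaAt θ e ^ (1 - 2 / p) := by
  have key := h.abs_cov_le i i j j (a := 1) (b := 1) (by norm_num)
    (A := {i}) (B := {j}) (by simp) (by simp)
    (U := fun y => y i) (V := fun y => y j) (U' := fun T y => clip T (y i))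
    (V' := fun T y => clip T (y j)) (α := 1) (β := 1) zero_le_one zero_le_one
    (by fun_prop) (by fun_prop) (fun T => (continuous_clip _).comp (by fun_prop))
    (fun T => (continuous_clip _).comp (by fun_prop))
    (fun y => by simpa using (abs_le_envelope i i j j y).1)
    (fun y => by simpa using (abs_le_envelope i i j j y).2.2.1)
    (fun T y => by
      simpa using (abs_clip_le_abs T.cast_nonneg _).trans (abs_le_envelope i i j j y).1)
    (fun T y => by
      simpa using (abs_clip_le_abs T.cast_nonneg _).trans (abs_le_envelope i i j j y).2.2.1)
    (fun T y hy => clip_eq_self ((abs_le_envelope i i j j y).1.trans hy))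
    (fun T y hy => clip_eq_self ((abs_le_envelope i i j j y).2.2.1.trans hy))
    (fun T => Or.inl (Or.inl (Or.inl (Or.inl ⟨(T, i), rfl⟩))))
    (fun T => Or.inl (Or.inl (Or.inl (Or.inl ⟨(T, j), rfl⟩))))
    (fun T hT => by simpa using isBddLipOn_clip (by exact_mod_cast hT) (Finset.mem_singleton_self i))
    (fun T hT => by simpa using isBddLipOn_clip (by exact_mod_cast hT) (Finset.mem_singleton_self j))
    (e := e) (fun x hx y hy => by
      rwa [Finset.mem_singleton.1 hx, Finset.mem_singleton.1 hy])
  rw [h.integral_eq_zero i, zero_mul, sub_zero] at key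
  refine key.trans ?_
  have hc := h.le_covConst (r := 2) (x := 4) (by norm_num) (by norm_num)
  have ht : 0 ≤ thetaAt θ e ^ (1 - 2 / p) := Real.rpow_nonneg (thetaAt_nonneg h.theta_nonneg _) _
  calc _ = 2 ^ 2 * (K * 4 * Θ + 6 * (1 + 4 * M) ^ 2) * thetaAt θ e ^ (1 - 2 / p) := by
        simp only [Finset.card_singleton]
        norm_num
        ring_nf
        simp
    _ ≤ _ := by gcongr

theorem card_pair_le (i j : Fin n) : ((({i, j} : Finset (Fin n)).card : ℕ) : ℝ) ≤ 2 := by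
  exact_mod_cast Finset.card_le_two

/-- A covariance, since y k is centred. The absolute value on y i alone is the form in which the
Taylor remainder |y_i| D_i² expands. -/
theorem abs_integral_triple_le (h : PsiDependentLaw Q G θ p K M Θ) (i j k : Fin n) :
    |∫ y, |y i| * y j * y k ∂Q|
      ≤ covConst K M Θ * thetaAt θ (min (G.edist k i) (G.edist k j)) ^ (1 - 3 / p) := by
  have hb := fun y => abs_le_envelope i j k k y
  have key := h.abs_cov_le i j k k (a := 2) (b := 1) (by norm_num)
    (A := {i, j}) (B := {k}) (by simp) (by simp)
    (U := fun y => |y i| * y j) (V := fun y => y k)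
    (U' := fun T y => |clip T (y i)| * clip T (y j))
    (V' := fun T y => clip T (y k)) (α := 2) (β := 1) zero_le_two zero_le_one
    (by fun_prop) (by fun_prop)
    (fun T => ((continuous_clip _).comp (by fun_prop)).abs.mul ((continuous_clip _).comp (by fun_prop)))
    (fun T => (continuous_clip _).comp (by fun_prop))
    (fun y => by
      rw [abs_mul, abs_abs, sq]
      exact mul_le_mul (hb y).1 (hb y).2.1 (abs_nonneg _) ((abs_nonneg _).trans (hb y).1))
    (fun y => by simpa using (hb y).2.2.1)
    (fun T y => by
      rw [abs_mul, abs_abs, sq]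
      exact mul_le_mul ((abs_clip_le_abs T.cast_nonneg _).trans (hb y).1)
        ((abs_clip_le_abs T.cast_nonneg _).trans (hb y).2.1) (abs_nonneg _)
        ((abs_nonneg _).trans (hb y).1))
    (fun T y => by simpa using (abs_clip_le_abs T.cast_nonneg _).trans (hb y).2.2.1)
    (fun T y hy => by
      rw [clip_eq_self ((hb y).1.trans hy), clip_eq_self ((hb y).2.1.trans hy)])
    (fun T y hy => clip_eq_self ((hb y).2.2.1.trans hy))
    (fun T => Or.inl (Or.inl (Or.inr ⟨(T, i, j), rfl⟩)))
    (fun T => Or.inl (Or.inl (Or.inl (Or.inl ⟨(T, k), rfl⟩))))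
    (fun T hT => by
      have hT' : (1 : ℝ) ≤ T := by exact_mod_cast hT
      have := IsBddLipOn.mul (by linarith) (by linarith)
        (isBddLipOn_clip (A := {i, j}) hT' (i := i) (by simp)).abs
        (isBddLipOn_clip (A := {i, j}) hT' (i := j) (by simp))
      convert this using 1 <;> ring)
    (fun T hT => by simpa using isBddLipOn_clip (by exact_mod_cast hT) (Finset.mem_singleton_self k))
    (e := min (G.edist k i) (G.edist k j)) (fun x hx y hy => by
      simp only [Finset.mem_insert, Finset.mem_singleton] at hx hy
      rw [SimpleGraph.edist_comm (u := x), hy]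
      rcases hx with rfl | rfl <;> simp)
  rw [h.integral_eq_zero k, mul_zero, sub_zero] at key
  refine key.trans ?_
  have hc := h.le_covConst (r := 3) (x := 12) (by norm_num) (by norm_num)
  have ht : 0 ≤ thetaAt θ (min (G.edist k i) (G.edist k j)) ^ (1 - 3 / p) :=
    Real.rpow_nonneg (thetaAt_nonneg h.theta_nonneg _) _
  have hK := h.K_nonneg
  have hΘ := h.one_le_Theta
  have hcard := card_pair_le i j
  calc _ = 2 ^ 3 * (K * ((({i, j} : Finset (Fin n)).card : ℝ) * 6) * Θ + 6 * (1 + 4 * M) ^ 2)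
          * thetaAt θ (min (G.edist k i) (G.edist k j)) ^ (1 - 3 / p) := by
        simp only [Finset.card_singleton]
        norm_num
        ring_nf
        simp
    _ ≤ 2 ^ 3 * (K * (2 * 6) * Θ + 6 * (1 + 4 * M) ^ 2)
          * thetaAt θ (min (G.edist k i) (G.edist k j)) ^ (1 - 3 / p) := by gcongr
    _ ≤ _ := by
        norm_num at hc ⊢
        gcongr

theorem abs_cov_mul_mul_le (h : PsiDependentLaw Q G θ p K M Θ) (i j k l : Fin n) :
    |∫ y, (y i * y j) * (y k * y l) ∂Q - (∫ y, y i * y j ∂Q) * ∫ y, y k * y l ∂Q|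
      ≤ covConst K M Θ * thetaAt θ
        (min (min (G.edist i k) (G.edist i l)) (min (G.edist j k) (G.edist j l))) ^ (1 - 4 / p) := by
  have hb := fun y => abs_le_envelope i j k l y
  set e := min (min (G.edist i k) (G.edist i l)) (min (G.edist j k) (G.edist j l)) with he
  have key := h.abs_cov_le i j k l (a := 2) (b := 2) (by norm_num)
    (A := {i, j}) (B := {k, l}) (by simp) (by simp)
    (U := fun y => y i * y j) (V := fun y => y k * y l)
    (U' := fun T y => clip T (y i) * clip T (y j))
    (V' := fun T y => clip T (y k) * clip T (y l)) (α := 2) (β := 2) zero_le_two zero_le_two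
    (by fun_prop) (by fun_prop)
    (fun T => ((continuous_clip _).comp (by fun_prop)).mul ((continuous_clip _).comp (by fun_prop)))
    (fun T => ((continuous_clip _).comp (by fun_prop)).mul ((continuous_clip _).comp (by fun_prop)))
    (fun y => by
      rw [abs_mul, sq]
      exact mul_le_mul (hb y).1 (hb y).2.1 (abs_nonneg _) ((abs_nonneg _).trans (hb y).1))
    (fun y => by
      rw [abs_mul, sq]
      exact mul_le_mul (hb y).2.2.1 (hb y).2.2.2 (abs_nonneg _) ((abs_nonneg _).trans (hb y).1))
    (fun T y => by
      rw [abs_mul, sq]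
      exact mul_le_mul ((abs_clip_le_abs T.cast_nonneg _).trans (hb y).1)
        ((abs_clip_le_abs T.cast_nonneg _).trans (hb y).2.1) (abs_nonneg _)
        ((abs_nonneg _).trans (hb y).1))
    (fun T y => by
      rw [abs_mul, sq]
      exact mul_le_mul ((abs_clip_le_abs T.cast_nonneg _).trans (hb y).2.2.1)
        ((abs_clip_le_abs T.cast_nonneg _).trans (hb y).2.2.2) (abs_nonneg _)
        ((abs_nonneg _).trans (hb y).1))
    (fun T y hy => by
      rw [clip_eq_self ((hb y).1.trans hy), clip_eq_self ((hb y).2.1.trans hy)])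
    (fun T y hy => by
      rw [clip_eq_self ((hb y).2.2.1.trans hy), clip_eq_self ((hb y).2.2.2.trans hy)])
    (fun T => Or.inl (Or.inl (Or.inl (Or.inr ⟨(T, i, j), rfl⟩))))
    (fun T => Or.inl (Or.inl (Or.inl (Or.inr ⟨(T, k, l), rfl⟩))))
    (fun T hT => by
      have hT' : (1 : ℝ) ≤ T := by exact_mod_cast hT
      have := IsBddLipOn.mul (by linarith) (by linarith)
        (isBddLipOn_clip (A := {i, j}) hT' (i := i) (by simp))
        (isBddLipOn_clip (A := {i, j}) hT' (i := j) (by simp))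
      convert this using 1 <;> ring)
    (fun T hT => by
      have hT' : (1 : ℝ) ≤ T := by exact_mod_cast hT
      have := IsBddLipOn.mul (by linarith) (by linarith)
        (isBddLipOn_clip (A := {k, l}) hT' (i := k) (by simp))
        (isBddLipOn_clip (A := {k, l}) hT' (i := l) (by simp))
      convert this using 1 <;> ring)
    (e := e) (fun x hx y hy => by
      simp only [Finset.mem_insert, Finset.mem_singleton] at hx hy
      rcases hx with rfl | rfl <;> rcases hy with rfl | rfl <;> simp [he])
  refine key.trans ?_
  have hc := h.le_covConst (r := 4) (x := 36) (by norm_num) (by norm_num)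
  have ht : 0 ≤ thetaAt θ e ^ (1 - 4 / p) :=
    Real.rpow_nonneg (thetaAt_nonneg h.theta_nonneg _) _
  have hK := h.K_nonneg
  have hΘ := h.one_le_Theta
  have hcard := card_pair_le i j
  have hcard' := card_pair_le k l
  calc _ = 2 ^ 4 * (K * ((({i, j} : Finset (Fin n)).card : ℝ) * (({k, l} : Finset (Fin n)).card : ℝ)
          * 9) * Θ + 6 * (1 + 4 * M) ^ 2) * thetaAt θ e ^ (1 - 4 / p) := by
        norm_num
        ring_nf
        simp
    _ ≤ 2 ^ 4 * (K * (2 * 2 * 9) * Θ + 6 * (1 + 4 * M) ^ 2) * thetaAt θ e ^ (1 - 4 / p) := by gcongr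
    _ ≤ _ := by
        norm_num at hc ⊢
        gcongr

theorem integrable_eval (h : PsiDependentLaw Q G θ p K M Θ) (i : Fin n) :
    Integrable (fun y : Fin n → ℝ => y i) Q :=
  (h.integrable_of_abs_le i i i i (measurable_pi_apply i).aestronglyMeasurable fun y =>
    ((abs_le_envelope i i i i y).1.trans
      (le_self_pow₀ (one_le_envelope i i i i y) (by norm_num)))).1

theorem integrable_quadruple (h : PsiDependentLaw Q G θ p K M Θ) (i j k l : Fin n) :
    Integrable (fun y : Fin n → ℝ => (y i * y j) * (y k * y l)) Q :=
  (h.integrable_of_abs_le i j k l (by fun_prop) fun y => by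
    obtain ⟨h1, h2, h3, h4⟩ := abs_le_envelope i j k l y
    have := one_le_envelope i j k l y
    rw [abs_mul, abs_mul, abs_mul]
    calc _ ≤ (envelope i j k l y * envelope i j k l y) * (envelope i j k l y * envelope i j k l y) := by
          gcongr
      _ = _ := by ring).1

theorem integrable_triple (h : PsiDependentLaw Q G θ p K M Θ) (i j k : Fin n) :
    Integrable (fun y : Fin n → ℝ => |y i| * y j * y k) Q :=
  (h.integrable_of_abs_le i j k k (by fun_prop) fun y => by
    obtain ⟨h1, h2, h3, -⟩ := abs_le_envelope i j k k y
    have := one_le_envelope i j k k y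
    rw [abs_mul, abs_mul, abs_abs]
    calc _ ≤ envelope i j k k y * envelope i j k k y * envelope i j k k y := by
          gcongr
      _ = envelope i j k k y ^ 3 := by ring
      _ ≤ _ := pow_le_pow_right₀ this (by norm_num)).1

theorem memLp_mul (h : PsiDependentLaw Q G θ p K M Θ) (i j : Fin n) :
    MemLp (fun y : Fin n → ℝ => y i * y j) 2 Q := by
  rw [memLp_two_iff_integrable_sq (by fun_prop)]
  exact (h.integrable_quadruple i j i j).congr (ae_of_all _ fun y => by ring)

theorem memLp_eval (h : PsiDependentLaw Q G θ p K M Θ) (i : Fin n) :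
    MemLp (fun y : Fin n → ℝ => y i) 2 Q := by
  rw [memLp_two_iff_integrable_sq (measurable_pi_apply i).aestronglyMeasurable]
  exact ((h.memLp_mul i i).integrable (by norm_num)).congr (ae_of_all _ fun y => by ring)

theorem abs_integral_mul_cos_le (h : PsiDependentLaw Q G θ p K M Θ) (i : Fin n)
    (A : Finset (Fin n)) (m : ℕ) (hA : ∀ j ∈ A, (m : ℕ∞) ≤ G.edist i j) (u : ℝ) {c : ℝ}
    (hc : c = 0 ∨ c = -(Real.pi / 2)) :
    |∫ y, y i * Real.cos (u * ∑ j ∈ A, y j + c) ∂Q|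
      ≤ n * (1 + |u|) * covConst K M Θ * θ m ^ (1 - 1 / p) := by
  have hK := h.K_nonneg
  have hΘ := h.one_le_Theta
  have hC := h.covConst_nonneg
  have ht : 0 ≤ θ m ^ (1 - 1 / p) := Real.rpow_nonneg (h.theta_nonneg m) _
  -- ψ-dependence concerns nonempty sets; for empty A the cosine is constant and centring suffices.
  rcases A.eq_empty_or_nonempty with rfl | hne
  · simp only [Finset.sum_empty, mul_zero, zero_add]
    rw [integral_mul_const, h.integral_eq_zero, zero_mul, abs_zero]
    positivity
  have hn : (1 : ℝ) ≤ n := by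
    have : 0 < n := i.pos
    exact_mod_cast this
  have hcard : (A.card : ℝ) ≤ n := by
    have := Finset.card_le_univ A
    rw [Fintype.card_fin] at this
    exact_mod_cast this
  -- Only rational frequencies are test functions. The frequency needed later is u/σ, which is
  -- arbitrary and is reached by continuity in u.
  have hrat : ∀ u : ℚ, |∫ y, y i * Real.cos (u * ∑ j ∈ A, y j + c) ∂Q|
      ≤ n * (1 + |(u : ℝ)|) * covConst K M Θ * θ m ^ (1 - 1 / p) := by
    intro u
    have key := h.abs_cov_le i i i i (a := 1) (b := 0) (by norm_num)
      (A := {i}) (B := A) (by simp) hne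
      (U := fun y => y i) (V := fun y => Real.cos (u * ∑ j ∈ A, y j + c))
      (U' := fun T y => clip T (y i))
      (V' := fun T y => Real.cos (u * ∑ j ∈ A, y j + c)) (α := 1) (β := |(u : ℝ)|)
      zero_le_one (abs_nonneg _)
      (by fun_prop) (by fun_prop) (fun T => (continuous_clip _).comp (by fun_prop))
      (fun T => by fun_prop)
      (fun y => by simpa using (abs_le_envelope i i i i y).1)
      (fun y => by simpa using Real.abs_cos_le_one _)
      (fun T y => by
        simpa using (abs_clip_le_abs T.cast_nonneg _).trans (abs_le_envelope i i i i y).1)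
      (fun T y => by simpa using Real.abs_cos_le_one _)
      (fun T y hy => clip_eq_self ((abs_le_envelope i i i i y).1.trans hy))
      (fun T y hy => rfl)
      (fun T => Or.inl (Or.inl (Or.inl (Or.inl ⟨(T, i), rfl⟩))))
      (fun T => by
        rcases hc with rfl | rfl
        · exact Or.inl (Or.inr ⟨(u, A), rfl⟩)
        · exact Or.inr ⟨(u, A), rfl⟩)
      (fun T hT => by
        simpa using isBddLipOn_clip (by exact_mod_cast hT) (Finset.mem_singleton_self i))
      (fun T hT => by simpa using isBddLipOn_cos (A := A) u c)
      (e := m) (fun x hx y hy => by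
        rw [Finset.mem_singleton.1 hx]; exact hA y hy)
    rw [h.integral_eq_zero i, zero_mul, sub_zero, thetaAt_coe] at key
    refine key.trans ?_
    have hu : 0 ≤ |(u : ℝ)| := abs_nonneg _
    have h1 : (1 : ℝ) ≤ n * (1 + |(u : ℝ)|) := by nlinarith
    have hc := h.le_covConst (r := 1) (x := 2) (by norm_num) (by norm_num)
    calc _ = 2 ^ 1 * (K * (A.card * (1 + |(u : ℝ)|) * 2) * Θ + 6 * (1 + 4 * M) ^ 2)
            * θ m ^ (1 - 1 / p) := by
          simp only [Finset.card_singleton]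
          norm_num
          left
          ring_nf
          simp
      _ ≤ 2 ^ 1 * (K * (n * (1 + |(u : ℝ)|) * 2) * Θ
            + n * (1 + |(u : ℝ)|) * (6 * (1 + 4 * M) ^ 2)) * θ m ^ (1 - 1 / p) := by
          have h6 := le_mul_of_one_le_left (by positivity : 0 ≤ 6 * (1 + 4 * M) ^ 2) h1
          gcongr (_ * (?_ + ?_) * _)
          gcongr
      _ = n * (1 + |(u : ℝ)|) * (2 ^ 1 * (K * 2 * Θ + 6 * (1 + 4 * M) ^ 2))
            * θ m ^ (1 - 1 / p) := by ring
      _ ≤ _ := by gcongr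
  have hcont : Continuous fun u : ℝ => ∫ y, y i * Real.cos (u * ∑ j ∈ A, y j + c) ∂Q := by
    refine continuous_of_dominated (bound := fun y => |y i|) (fun u => by fun_prop)
      (fun u => ae_of_all _ fun y => ?_) (h.integrable_eval i).abs (ae_of_all _ fun y => by fun_prop)
    rw [norm_mul]
    exact mul_le_of_le_one_right (norm_nonneg _) (Real.abs_cos_le_one _)
  exact (Rat.denseRange_cast (𝕜 := ℝ)).induction_on
    (p := fun u : ℝ => |∫ y, y i * Real.cos (u * ∑ j ∈ A, y j + c) ∂Q|
      ≤ n * (1 + |u|) * covConst K M Θ * θ m ^ (1 - 1 / p)) u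
    (isClosed_le hcont.abs (by fun_prop)) hrat

end PsiDependentLaw

/-! ### Stein's method for the normalized sum -/

/-- A second-order remainder valid for all t: the addition formula reduces it to 1 - cos t and t -
sin t, bounded by t² and 2t². A shift of x by -π/2 covers the sine. -/
theorem abs_cos_taylor_le (x t : ℝ) :
    |Real.cos x - Real.cos (x - t) + t * Real.sin x| ≤ 3 * t ^ 2 := by
  have hsin : |t - Real.sin t| ≤ 2 * t ^ 2 := by
    rcases le_or_gt |t| 1 with h | h
    · have h1 := Real.sin_bound h
      have e : t - Real.sin t = -(Real.sin t - (t - t ^ 3 / 6)) + t ^ 3 / 6 := by ring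
      have h2 : |t| ^ 3 ≤ t ^ 2 := by
        rw [← sq_abs t, pow_succ]; exact mul_le_of_le_one_right (by positivity) h
      have h3 : |t| ^ 5 ≤ t ^ 2 := by
        rw [← sq_abs t, show |t| ^ 5 = |t| ^ 2 * |t| ^ 3 by ring]
        exact mul_le_of_le_one_right (by positivity) (pow_le_one₀ (abs_nonneg _) h)
      have h4 : |t ^ 3 / 6| = |t| ^ 3 / 6 := by rw [abs_div, abs_pow]; norm_num
      rw [e]
      refine (abs_add_le _ _).trans ?_
      rw [abs_neg, h4]
      nlinarith [sq_nonneg t]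
    · have h2 : |t| ≤ t ^ 2 := by rw [← sq_abs t]; nlinarith
      have h3 : 1 ≤ t ^ 2 := by linarith
      exact (abs_sub _ _).trans (by linarith [Real.abs_sin_le_one t])
  have hcos : |1 - Real.cos t| ≤ t ^ 2 := by
    rw [abs_of_nonneg (by linarith [Real.cos_le_one t])]
    nlinarith [Real.one_sub_sq_div_two_le_cos (x := t), sq_nonneg t]
  have e : Real.cos x - Real.cos (x - t) + t * Real.sin x
      = Real.cos x * (1 - Real.cos t) + Real.sin x * (t - Real.sin t) := by
    rw [Real.cos_sub]; ring
  rw [e]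
  refine (abs_add_le _ _).trans ?_
  rw [abs_mul, abs_mul]
  calc _ ≤ 1 * t ^ 2 + 1 * (2 * t ^ 2) := by
        gcongr
        · exact Real.abs_cos_le_one x
        · exact Real.abs_sin_le_one x
    _ = _ := by ring

namespace PsiDependentLaw

variable {n : ℕ} {Q : Measure (Fin n → ℝ)} {G : SimpleGraph (Fin n)}
  {θ : ℕ → ℝ} {p K M Θ : ℝ}

theorem coefficient_nonneg (h : PsiDependentLaw Q G θ p K M Θ) (q : ℝ) (e : ℕ∞) :
    0 ≤ thetaAt θ e ^ q :=
  Real.rpow_nonneg (thetaAt_nonneg h.theta_nonneg _) _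

theorem exponent_pos (h : PsiDependentLaw Q G θ p K M Θ) {r : ℝ} (hr : r ≤ 4) : 0 < 1 - r / p := by
  have := h.four_lt
  rw [sub_pos, div_lt_one (by linarith)]; linarith

theorem coefficient_top (h : PsiDependentLaw Q G θ p K M Θ) {r : ℝ} (hr : r ≤ 4) :
    thetaAt θ ⊤ ^ (1 - r / p) = 0 := by
  rw [thetaAt_top, Real.zero_rpow (h.exponent_pos hr).ne']

/-- `n ∑_s c(s, m; k) θ_s^{1 - (2 + k) / p}`. -/
noncomputable def netSum (G : SimpleGraph (Fin n)) (θ : ℕ → ℝ) (p : ℝ) (m k : ℕ) : ℝ :=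
  n * ∑' s : ℕ, cNet G s m (k : ℝ) * θ s ^ (1 - (2 + (k : ℝ)) / p)

theorem netSum_eq (G : SimpleGraph (Fin n)) (θ : ℕ → ℝ) (p : ℝ) (m k : ℕ) :
    netSum G θ p m k = n * ∑' s : ℕ, cNet G s m (k : ℝ) * thetaAt θ s ^ (1 - (2 + (k : ℝ)) / p) := by
  simp only [netSum, thetaAt_coe]

theorem netSum_nonneg (h : PsiDependentLaw Q G θ p K M Θ) (m k : ℕ) : 0 ≤ netSum G θ p m k := by
  rw [netSum_eq]
  exact mul_nonneg (Nat.cast_nonneg _)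
    (tsum_cNet_mul_nonneg G (w := fun e => thetaAt θ e ^ (1 - (2 + (k : ℝ)) / p))
      (fun e => h.coefficient_nonneg _ e) m k)

theorem sum_coefficient_le (h : PsiDependentLaw Q G θ p K M Θ) (m : ℕ) :
    ∑ i, ∑ j, thetaAt θ (G.edist i j) ^ (1 - 3 / p) ≤ netSum G θ p m 1 := by
  have := sum_pair_le G (w := fun e => thetaAt θ e ^ (1 - 3 / p))
    (h.coefficient_nonneg _) (h.coefficient_top (by norm_num)) m
  rw [netSum_eq]
  norm_num at this ⊢
  exact this

/-- Each diagonal pair contributes θ_0 = 1. This later controls 1/σ when σ is small. -/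
theorem le_netSum (h : PsiDependentLaw Q G θ p K M Θ) (m : ℕ) : (n : ℝ) ≤ netSum G θ p m 1 := by
  refine le_trans ?_ (h.sum_coefficient_le m)
  calc (n : ℝ) = ∑ i : Fin n, thetaAt θ (G.edist i i) ^ (1 - 3 / p) := by
        have h0 : thetaAt θ 0 = 1 := by
          have := thetaAt_coe θ 0
          rwa [h.theta_zero, Nat.cast_zero] at this
        simp [h0]
    _ ≤ _ := Finset.sum_le_sum fun i _ => Finset.single_le_sum
        (f := fun j => thetaAt θ (G.edist i j) ^ (1 - 3 / p))
        (fun j _ => h.coefficient_nonneg _ _) (Finset.mem_univ i)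

variable [IsProbabilityMeasure Q]

/-- The covariances between distant nodes are negligible. -/
theorem sum_abs_integral_far_le (h : PsiDependentLaw Q G θ p K M Θ) (m : ℕ) :
    ∑ i, ∑ j ∈ (nbhd G i m)ᶜ, |∫ y, y i * y j ∂Q|
      ≤ covConst K M Θ * √((n : ℝ) ^ 2 * θ m ^ (1 - 1 / p) * netSum G θ p m 1) := by
  have hp := h.four_lt
  have hC := h.covConst_nonneg
  set B : Fin n → Fin n → ℝ := fun i j => thetaAt θ (G.edist i j) ^ (1 - 3 / p) with hB
  have hB0 : ∀ i j, 0 ≤ B i j := fun i j => h.coefficient_nonneg _ _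
  set a := θ m ^ (1 - 1 / p) with ha
  have ha0 : 0 ≤ a := Real.rpow_nonneg (h.theta_nonneg m) _
  have hpt : ∀ i, ∀ j ∈ (nbhd G i m)ᶜ, |∫ y, y i * y j ∂Q|
      ≤ covConst K M Θ * (√a * √(B i j)) := by
    intro i j hj
    rw [Finset.mem_compl, mem_nbhd, not_le] at hj
    have h1 := h.abs_integral_mul_le i j le_rfl
    have h2 := h.abs_integral_mul_le i j hj.le
    rw [thetaAt_coe] at h2
    -- Both bounds on the covariance hold, so θ may be replaced by the smaller coefficient t. Then
    -- t^{1-2/p} is the geometric mean of t^{1-1/p} and t^{1-3/p}, which are charged to θ_m and to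
    -- the distance respectively.
    set t := min (θ m) (thetaAt θ (G.edist i j)) with ht
    have ht0 : 0 ≤ t := le_min (h.theta_nonneg m) (thetaAt_nonneg h.theta_nonneg _)
    have h3 : |∫ y, y i * y j ∂Q| ≤ covConst K M Θ * t ^ (1 - 2 / p) := by
      rcases min_choice (θ m) (thetaAt θ (G.edist i j)) with e | e
      · rw [ht, e]; exact h2
      · rw [ht, e]; exact h1
    refine h3.trans (mul_le_mul_of_nonneg_left ?_ hC)
    have e1 : t ^ (1 - 2 / p) = √(t ^ (1 - 1 / p) * t ^ (1 - 3 / p)) := by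
      have h1 := h.exponent_pos (r := 1) (by norm_num)
      have h3 := h.exponent_pos (r := 3) (by norm_num)
      rw [← Real.rpow_add_of_nonneg ht0 h1.le h3.le, Real.sqrt_eq_rpow, ← Real.rpow_mul ht0]
      congr 1; ring
    rw [e1, ← Real.sqrt_mul ha0]
    refine Real.sqrt_le_sqrt ?_
    exact mul_le_mul (Real.rpow_le_rpow ht0 (min_le_left _ _) (h.exponent_pos (by norm_num)).le)
      (Real.rpow_le_rpow ht0 (min_le_right _ _) (h.exponent_pos (by norm_num)).le)
      (Real.rpow_nonneg ht0 _) ha0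
  have hsum : ∑ i, ∑ j, √(B i j) ≤ n * √(netSum G θ p m 1) := by
    have hcs := Real.sum_sqrt_mul_sqrt_le (Finset.univ : Finset (Fin n × Fin n))
      (f := fun _ => (1 : ℝ)) (g := fun q => B q.1 q.2) (fun _ => zero_le_one) fun q => hB0 _ _
    simp only [Real.sqrt_one, one_mul, Finset.sum_const, Finset.card_univ, Fintype.card_prod,
      Fintype.card_fin, nsmul_eq_mul, mul_one, Fintype.sum_prod_type] at hcs
    push_cast at hcs
    rw [Real.sqrt_mul_self (Nat.cast_nonneg _)] at hcs
    exact hcs.trans (mul_le_mul_of_nonneg_left (Real.sqrt_le_sqrt (h.sum_coefficient_le m))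
      (Nat.cast_nonneg _))
  calc _ ≤ ∑ i, ∑ j ∈ (nbhd G i m)ᶜ, covConst K M Θ * (√a * √(B i j)) :=
        Finset.sum_le_sum fun i _ => Finset.sum_le_sum fun j hj => hpt i j hj
    _ ≤ ∑ i, ∑ j, covConst K M Θ * (√a * √(B i j)) :=
        Finset.sum_le_sum fun i _ => Finset.sum_le_sum_of_subset_of_nonneg (Finset.subset_univ _)
          fun j _ _ => by positivity
    _ = covConst K M Θ * (√a * ∑ i, ∑ j, √(B i j)) := by
        simp only [Finset.mul_sum]
    _ ≤ covConst K M Θ * (√a * (n * √(netSum G θ p m 1))) := by gcongr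
    _ = _ := by
        rw [Real.sqrt_mul (by positivity), Real.sqrt_mul (by positivity),
          Real.sqrt_sq (Nat.cast_nonneg _)]
        ring

/-- Expanding the square gives triples with j, k ∈ N(i; m). The restriction on k can be dropped
after passing to the nonnegative bounds, which leaves the sum of `sum_triple_le`. -/
theorem sum_integral_abs_mul_sq_le (h : PsiDependentLaw Q G θ p K M Θ) (m : ℕ) :
    ∑ i, ∫ y, |y i| * (∑ j ∈ nbhd G i m, y j) ^ 2 ∂Q
      ≤ covConst K M Θ * (2 * netSum G θ p m 1) := by
  classical
  have hC := h.covConst_nonneg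
  set w : ℕ∞ → ℝ := fun e => thetaAt θ e ^ (1 - 3 / p) with hw
  have hpt : ∀ i, ∫ y, |y i| * (∑ j ∈ nbhd G i m, y j) ^ 2 ∂Q
      ≤ ∑ j, ∑ k, (if G.edist i j ≤ m then
        covConst K M Θ * w (min (G.edist k i) (G.edist k j)) else 0) := by
    intro i
    have e : ∀ y : Fin n → ℝ, |y i| * (∑ j ∈ nbhd G i m, y j) ^ 2
        = ∑ j ∈ nbhd G i m, ∑ k ∈ nbhd G i m, |y i| * y j * y k := by
      intro y
      rw [sq, Finset.sum_mul_sum, Finset.mul_sum]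
      refine Finset.sum_congr rfl fun j _ => ?_
      rw [Finset.mul_sum]
      exact Finset.sum_congr rfl fun k _ => by ring
    simp only [e]
    rw [integral_finsetSum _ fun j _ => integrable_finsetSum _ fun k _ => h.integrable_triple i j k]
    calc _ = ∑ j ∈ nbhd G i m, ∑ k ∈ nbhd G i m, ∫ y, |y i| * y j * y k ∂Q :=
          Finset.sum_congr rfl fun j _ => integral_finsetSum _ fun k _ => h.integrable_triple i j k
      _ ≤ ∑ j ∈ nbhd G i m, ∑ k, covConst K M Θ * w (min (G.edist k i) (G.edist k j)) := by
          refine Finset.sum_le_sum fun j _ => ?_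
          calc _ ≤ ∑ k ∈ nbhd G i m, covConst K M Θ * w (min (G.edist k i) (G.edist k j)) :=
                Finset.sum_le_sum fun k _ => (le_abs_self _).trans (h.abs_integral_triple_le i j k)
            _ ≤ _ := Finset.sum_le_sum_of_subset_of_nonneg (Finset.subset_univ _)
                fun k _ _ => mul_nonneg hC (h.coefficient_nonneg _ _)
      _ = _ := by
          rw [nbhd, Finset.sum_filter]
          refine Finset.sum_congr rfl fun j _ => ?_
          split_ifs
          · rfl
          · simp
  have ht := sum_triple_le G (w := w) (h.coefficient_nonneg _)
    (h.coefficient_top (by norm_num)) m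
  have hns : netSum G θ p m 1 = n * ∑' s : ℕ, cNet G s m ((1 : ℕ) : ℝ) * w s := by
    rw [netSum_eq]; norm_num [hw]
  rw [hns]
  refine (Finset.sum_le_sum fun i _ => hpt i).trans ?_
  refine le_trans (le_of_eq ?_) (mul_le_mul_of_nonneg_left ht hC)
  simp only [Finset.mul_sum, mul_ite, mul_zero]

/-- `∑_i y_i ∑_{j ∈ N(i; m)} y_j`. -/
noncomputable def localSum (G : SimpleGraph (Fin n)) (m : ℕ) (y : Fin n → ℝ) : ℝ :=
  ∑ i, ∑ j ∈ nbhd G i m, y i * y j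

theorem memLp_localSum (h : PsiDependentLaw Q G θ p K M Θ) (m : ℕ) :
    MemLp (localSum G m) 2 Q :=
  memLp_finsetSum _ fun i _ => memLp_finsetSum _ fun j _ => h.memLp_mul i j

/-- The variance is a sum of covariances of products over close pairs, that is, over the quadruples
of `sum_quadruple_le`. Fourth-order products are the reason for p > 4. -/
theorem variance_localSum_le (h : PsiDependentLaw Q G θ p K M Θ) (m : ℕ) :
    variance (localSum G m) Q ≤ covConst K M Θ * (4 * netSum G θ p m 2) := by
  classical
  have hC := h.covConst_nonneg
  set w : ℕ∞ → ℝ := fun e => thetaAt θ e ^ (1 - 4 / p) with hw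
  have hcov : ∀ i j k l, cov[fun y => y i * y j, fun y => y k * y l; Q]
      ≤ covConst K M Θ * w (min (min (G.edist i k) (G.edist i l)) (min (G.edist j k) (G.edist j l))) := by
    intro i j k l
    rw [covariance_eq_sub (h.memLp_mul i j) (h.memLp_mul k l)]
    exact (le_abs_self _).trans (h.abs_cov_mul_mul_le i j k l)
  have hinner : ∀ i, MemLp (fun y : Fin n → ℝ => ∑ j ∈ nbhd G i m, y i * y j) 2 Q :=
    fun i => memLp_finsetSum _ fun j _ => h.memLp_mul i j
  have hvar : variance (localSum G m) Q
      = ∑ i, ∑ k, ∑ j ∈ nbhd G i m, ∑ l ∈ nbhd G k m,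
        cov[fun y => y i * y j, fun y => y k * y l; Q] := by
    rw [← covariance_self (h.memLp_localSum m).aemeasurable]
    change cov[fun y => ∑ i, ∑ j ∈ nbhd G i m, y i * y j,
      fun y => ∑ i, ∑ j ∈ nbhd G i m, y i * y j; Q] = _
    rw [covariance_fun_sum_fun_sum hinner hinner]
    refine Finset.sum_congr rfl fun i _ => Finset.sum_congr rfl fun k _ => ?_
    exact covariance_fun_sum_fun_sum' (fun j _ => h.memLp_mul i j) fun l _ => h.memLp_mul k l
  have hns : netSum G θ p m 2 = n * ∑' s : ℕ, cNet G s m ((2 : ℕ) : ℝ) * w s := by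
    rw [netSum_eq]; norm_num [hw]
  have hq := sum_quadruple_le G (w := w) (h.coefficient_nonneg _)
    (h.coefficient_top le_rfl) m
  rw [hvar, hns]
  refine le_trans ?_ (mul_le_mul_of_nonneg_left hq hC)
  calc _ ≤ ∑ i, ∑ k, ∑ j ∈ nbhd G i m, ∑ l ∈ nbhd G k m, covConst K M Θ *
        w (min (min (G.edist i k) (G.edist i l)) (min (G.edist j k) (G.edist j l))) :=
        Finset.sum_le_sum fun i _ => Finset.sum_le_sum fun k _ => Finset.sum_le_sum fun j _ =>
          Finset.sum_le_sum fun l _ => hcov i j k l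
    _ = ∑ i, ∑ j, ∑ k, ∑ l, (if G.edist i j ≤ m ∧ G.edist k l ≤ m then covConst K M Θ *
        w (min (min (G.edist i k) (G.edist i l)) (min (G.edist j k) (G.edist j l))) else 0) := by
        refine Finset.sum_congr rfl fun i _ => ?_
        rw [Finset.sum_comm (s := Finset.univ (α := Fin n)) (t := Finset.univ (α := Fin n))
          (f := fun j k => ∑ l, _)]
        refine Finset.sum_congr rfl fun k _ => ?_
        simp only [nbhd, Finset.sum_filter]
        refine Finset.sum_congr rfl fun j _ => ?_
        by_cases hj : G.edist i j ≤ m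
        · simp only [hj, if_true, true_and]
        · simp [hj]
    _ = _ := by
        simp only [Finset.mul_sum, mul_ite, mul_zero]

theorem integral_abs_localSum_sub_le (h : PsiDependentLaw Q G θ p K M Θ) (m : ℕ) :
    ∫ y, |localSum G m y - ∫ z, localSum G m z ∂Q| ∂Q
      ≤ √(covConst K M Θ * (4 * netSum G θ p m 2)) := by
  set X : (Fin n → ℝ) → ℝ := fun y => |localSum G m y - ∫ z, localSum G m z ∂Q| with hX
  have hm : MemLp X 2 Q := ((h.memLp_localSum m).sub (memLp_const _)).abs
  have h0 := variance_nonneg X Q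
  -- Nonnegativity of the variance of |Z - E Z| is the inequality (E|Z - E Z|)² ≤ Var Z.
  rw [variance_eq_sub hm] at h0
  have h1 : ∫ y, (X ^ 2) y ∂Q = variance (localSum G m) Q := by
    rw [variance_eq_integral (h.memLp_localSum m).aemeasurable]
    simp [hX]
  refine Real.le_sqrt_of_sq_le ?_
  rw [h1] at h0
  linarith [h.variance_localSum_le m]

/-- By centring, the difference is exactly the sum of E[Y_i Y_j] over pairs at distance more than m.
-/
theorem abs_variance_sub_le (h : PsiDependentLaw Q G θ p K M Θ) (m : ℕ) :
    |variance (fun y : Fin n → ℝ => ∑ i, y i) Q - ∫ y, localSum G m y ∂Q|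
      ≤ covConst K M Θ * √((n : ℝ) ^ 2 * θ m ^ (1 - 1 / p) * netSum G θ p m 1) := by
  have hpair : ∀ i j, Integrable (fun y : Fin n → ℝ => y i * y j) Q :=
    fun i j => (h.memLp_mul i j).integrable (by norm_num)
  have hvar : variance (fun y : Fin n → ℝ => ∑ i, y i) Q = ∑ i, ∑ j, ∫ y, y i * y j ∂Q := by
    rw [← covariance_self (memLp_finsetSum _ fun i _ => h.memLp_eval i).aemeasurable,
      covariance_fun_sum_fun_sum h.memLp_eval h.memLp_eval]
    refine Finset.sum_congr rfl fun i _ => Finset.sum_congr rfl fun j _ => ?_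
    rw [covariance_eq_sub (h.memLp_eval i) (h.memLp_eval j), h.integral_eq_zero i]
    simp
  have hloc : ∫ y, localSum G m y ∂Q = ∑ i, ∑ j ∈ nbhd G i m, ∫ y, y i * y j ∂Q := by
    unfold localSum
    rw [integral_finsetSum _ fun i _ => integrable_finsetSum _ fun j _ => hpair i j]
    exact Finset.sum_congr rfl fun i _ => integral_finsetSum _ fun j _ => hpair i j
  rw [hvar, hloc, ← Finset.sum_sub_distrib]
  refine le_trans ?_ (h.sum_abs_integral_far_le m)
  refine (Finset.abs_sum_le_sum_abs _ _).trans (Finset.sum_le_sum fun i _ => ?_)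
  rw [← Finset.sum_add_sum_compl (nbhd G i m) fun j => ∫ y, y i * y j ∂Q, add_sub_cancel_left]
  exact Finset.abs_sum_le_sum_abs _ _

/-- Stein's identity for the normalized sum, up to an error. -/
theorem abs_integral_stein_le (h : PsiDependentLaw Q G θ p K M Θ) (m : ℕ) {σ : ℝ} (hσ : 0 < σ)
    (hvar : σ ^ 2 = variance (fun y : Fin n → ℝ => ∑ i, y i) Q) (u : ℝ) {c : ℝ}
    (hc : c = 0 ∨ c = -(Real.pi / 2)) :
    |∫ y : Fin n → ℝ, (((∑ i, y i) / σ) * Real.cos (u * ((∑ i, y i) / σ) + c)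
        + u * Real.sin (u * ((∑ i, y i) / σ) + c)) ∂Q|
      ≤ covConst K M Θ * ((n : ℝ) ^ 2 * θ m ^ (1 - 1 / p) / σ * (1 + |u| * (1 / σ)))
        + 6 * u ^ 2 * covConst K M Θ * (netSum G θ p m 1 / σ ^ 3)
        + |u| * (covConst K M Θ * √((n : ℝ) ^ 2 * θ m ^ (1 - 1 / p) / σ * (netSum G θ p m 1 / σ ^ 3))
          + √(4 * covConst K M Θ * (netSum G θ p m 2 / σ ^ 4))) := by
  have hC := h.covConst_nonneg
  set v := u / σ with hv
  set S : (Fin n → ℝ) → ℝ := fun y => ∑ i, y i with hS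
  set D : Fin n → (Fin n → ℝ) → ℝ := fun i y => ∑ j ∈ nbhd G i m, y j with hD
  set Sc : Fin n → (Fin n → ℝ) → ℝ := fun i y => ∑ j ∈ (nbhd G i m)ᶜ, y j with hSc
  -- The Taylor remainder when the neighbours of i are removed from the sum.
  set r : Fin n → (Fin n → ℝ) → ℝ := fun i y => Real.cos (v * S y + c) - Real.cos (v * Sc i y + c)
    + v * D i y * Real.sin (v * S y + c) with hr
  have hSDc : ∀ i y, S y = D i y + Sc i y := fun i y => (Finset.sum_add_sum_compl _ _).symm
  have hrle : ∀ i y, |r i y| ≤ 3 * v ^ 2 * D i y ^ 2 := by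
    intro i y
    have := abs_cos_taylor_le (v * S y + c) (v * D i y)
    have e : v * S y + c - v * D i y = v * Sc i y + c := by rw [hSDc i]; ring
    rw [e] at this
    refine this.trans (le_of_eq ?_)
    ring
  have hZ : ∀ y, localSum G m y = ∑ i, y i * D i y := fun y => by
    simp only [localSum, hD, Finset.mul_sum]
  -- Stein's decomposition: far terms, Taylor remainders, and the discrepancy between σ² and its
  -- local version. They are bounded by `hT1`, `hT2` and `hT3`.
  have hident : ∀ y, (S y / σ) * Real.cos (u * (S y / σ) + c) + u * Real.sin (u * (S y / σ) + c)
      = σ⁻¹ * ∑ i, y i * Real.cos (v * Sc i y + c) + σ⁻¹ * ∑ i, y i * r i y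
        + u / σ ^ 2 * (Real.sin (v * S y + c) * (σ ^ 2 - localSum G m y)) := by
    intro y
    have e1 : u * (S y / σ) = v * S y := by rw [hv]; ring
    have e2 : ∑ i, y i * r i y = S y * Real.cos (v * S y + c)
        - ∑ i, y i * Real.cos (v * Sc i y + c)
        + v * Real.sin (v * S y + c) * localSum G m y := by
      have e3 : ∀ i, y i * r i y = y i * Real.cos (v * S y + c) - y i * Real.cos (v * Sc i y + c)
          + v * Real.sin (v * S y + c) * (y i * D i y) := fun i => by
        simp only [hr]
        ring
      rw [Finset.sum_congr rfl fun i _ => e3 i, Finset.sum_add_distrib, Finset.sum_sub_distrib,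
        ← Finset.sum_mul, ← Finset.mul_sum, hZ]
    rw [e1, e2, hv]
    field_simp
    ring
  have hScont : Continuous S := by fun_prop
  have hDcont : ∀ i, Continuous (D i) := fun i => by fun_prop
  have hSccont : ∀ i, Continuous (Sc i) := fun i => by fun_prop
  have hrcont : ∀ i, Continuous (r i) := fun i => by fun_prop
  have hsq : ∀ i, Integrable (fun y => |y i| * D i y ^ 2) Q := by
    intro i
    have : Integrable (fun y : Fin n → ℝ => ∑ j ∈ nbhd G i m, ∑ k ∈ nbhd G i m,
        |y i| * y j * y k) Q :=
      integrable_finsetSum _ fun j _ => integrable_finsetSum _ fun k _ => h.integrable_triple i j k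
    refine this.congr (ae_of_all _ fun y => ?_)
    simp only [hD]
    rw [sq, Finset.sum_mul_sum, Finset.mul_sum]
    refine Finset.sum_congr rfl fun j _ => ?_
    rw [Finset.mul_sum]
    exact Finset.sum_congr rfl fun k _ => by ring
  have hI1 : ∀ i, Integrable (fun y => y i * Real.cos (v * Sc i y + c)) Q := by
    intro i
    refine (h.integrable_eval i).mono
      (((continuous_apply i).mul (by fun_prop)).aestronglyMeasurable) (ae_of_all _ fun y => ?_)
    rw [norm_mul]
    exact mul_le_of_le_one_right (norm_nonneg _) (Real.abs_cos_le_one _)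
  have hr2 : ∀ i y, |y i * r i y| ≤ 3 * v ^ 2 * (|y i| * D i y ^ 2) := by
    intro i y
    rw [abs_mul]
    calc _ ≤ |y i| * (3 * v ^ 2 * D i y ^ 2) := by gcongr; exact hrle i y
      _ = _ := by ring
  have hI2 : ∀ i, Integrable (fun y => y i * r i y) Q := fun i =>
    ((hsq i).const_mul (3 * v ^ 2)).mono' (((continuous_apply i).mul (hrcont i)).aestronglyMeasurable)
      (ae_of_all _ (hr2 i))
  have hZint : Integrable (localSum G m) Q := (h.memLp_localSum m).integrable (by norm_num)
  have hI3 : Integrable (fun y => σ ^ 2 - localSum G m y) Q := (integrable_const _).sub hZint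
  have hI3' : Integrable (fun y => Real.sin (v * S y + c) * (σ ^ 2 - localSum G m y)) Q := by
    refine hI3.mono (AEStronglyMeasurable.mul (by fun_prop) hI3.aestronglyMeasurable)
      (ae_of_all _ fun y => ?_)
    rw [norm_mul]
    exact mul_le_of_le_one_left (norm_nonneg _) (Real.abs_sin_le_one _)
  have hsplit : ∫ y, ((S y / σ) * Real.cos (u * (S y / σ) + c)
        + u * Real.sin (u * (S y / σ) + c)) ∂Q
      = σ⁻¹ * ∑ i, ∫ y, y i * Real.cos (v * Sc i y + c) ∂Q + σ⁻¹ * ∑ i, ∫ y, y i * r i y ∂Q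
        + u / σ ^ 2 * ∫ y, Real.sin (v * S y + c) * (σ ^ 2 - localSum G m y) ∂Q := by
    simp only [hident]
    have i1 := (integrable_finsetSum Finset.univ fun i _ => hI1 i).const_mul σ⁻¹
    have i2 := (integrable_finsetSum Finset.univ fun i _ => hI2 i).const_mul σ⁻¹
    have i12 : Integrable (fun y => σ⁻¹ * ∑ i, y i * Real.cos (v * Sc i y + c)
        + σ⁻¹ * ∑ i, y i * r i y) Q := i1.add i2
    rw [integral_add i12 (hI3'.const_mul _), integral_add i1 i2, integral_const_mul,
      integral_const_mul, integral_const_mul, integral_finsetSum _ fun i _ => hI1 i,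
      integral_finsetSum _ fun i _ => hI2 i]
  have hT1 : |∑ i, ∫ y, y i * Real.cos (v * Sc i y + c) ∂Q|
      ≤ n * (n * (1 + |v|) * covConst K M Θ * θ m ^ (1 - 1 / p)) := by
    refine (Finset.abs_sum_le_sum_abs _ _).trans ?_
    calc _ ≤ ∑ i : Fin n, n * (1 + |v|) * covConst K M Θ * θ m ^ (1 - 1 / p) := by
          refine Finset.sum_le_sum fun i _ => h.abs_integral_mul_cos_le i _ m (fun j hj => ?_) v hc
          rw [Finset.mem_compl, mem_nbhd, not_le] at hj
          exact hj.le
      _ = _ := by simp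
  have hT2 : |∑ i, ∫ y, y i * r i y ∂Q|
      ≤ 3 * v ^ 2 * (covConst K M Θ * (2 * netSum G θ p m 1)) := by
    refine (Finset.abs_sum_le_sum_abs _ _).trans ?_
    calc _ ≤ ∑ i, 3 * v ^ 2 * ∫ y, |y i| * D i y ^ 2 ∂Q := by
          refine Finset.sum_le_sum fun i _ => (abs_integral_le_integral_abs).trans ?_
          rw [← integral_const_mul]
          exact integral_mono (hI2 i).abs ((hsq i).const_mul _) (hr2 i)
      _ ≤ _ := by
          rw [← Finset.mul_sum]
          exact mul_le_mul_of_nonneg_left (h.sum_integral_abs_mul_sq_le m) (by positivity)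
  have hT3 : |∫ y, Real.sin (v * S y + c) * (σ ^ 2 - localSum G m y) ∂Q|
      ≤ covConst K M Θ * √((n : ℝ) ^ 2 * θ m ^ (1 - 1 / p) * netSum G θ p m 1)
        + √(covConst K M Θ * (4 * netSum G θ p m 2)) := by
    set E := ∫ z, localSum G m z ∂Q with hE
    have iE : Integrable (fun y => |localSum G m y - E|) Q := (hZint.sub (integrable_const _)).abs
    calc _ ≤ ∫ y, |Real.sin (v * S y + c) * (σ ^ 2 - localSum G m y)| ∂Q :=
          abs_integral_le_integral_abs
      _ ≤ ∫ y, (|σ ^ 2 - E| + |localSum G m y - E|) ∂Q := by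
          refine integral_mono hI3'.abs
            ((integrable_const _).add iE) fun y => ?_
          rw [abs_mul]
          calc _ ≤ 1 * |σ ^ 2 - localSum G m y| := by
                gcongr; exact Real.abs_sin_le_one _
            _ = |(σ ^ 2 - E) - (localSum G m y - E)| := by rw [one_mul]; congr 1; ring
            _ ≤ _ := abs_sub _ _
      _ = |σ ^ 2 - E| + ∫ y, |localSum G m y - E| ∂Q := by
          rw [integral_add (integrable_const _) iE]
          simp
      _ ≤ _ := by
          refine add_le_add ?_ (h.integral_abs_localSum_sub_le m)
          rw [hvar]
          exact h.abs_variance_sub_le m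
  have ht0 : 0 ≤ θ m ^ (1 - 1 / p) := Real.rpow_nonneg (h.theta_nonneg m) _
  have hn1 := h.netSum_nonneg m 1
  have hn2 := h.netSum_nonneg m 2
  rw [hsplit]
  refine (abs_add_three _ _ _).trans ?_
  rw [abs_mul, abs_mul, abs_mul, abs_of_pos (inv_pos.2 hσ), abs_div, abs_of_pos (by positivity : 0 < σ ^ 2)]
  refine add_le_add (add_le_add ?_ ?_) ?_
  · calc _ ≤ σ⁻¹ * (n * (n * (1 + |v|) * covConst K M Θ * θ m ^ (1 - 1 / p))) := by gcongr
      _ = _ := by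
        rw [hv, abs_div, abs_of_pos hσ]
        ring
  · calc _ ≤ σ⁻¹ * (3 * v ^ 2 * (covConst K M Θ * (2 * netSum G θ p m 1))) := by gcongr
      _ = _ := by
        rw [hv]
        field_simp
        ring
  · refine (mul_le_mul_of_nonneg_left hT3 (by positivity)).trans (le_of_eq ?_)
    have e1 : √((n : ℝ) ^ 2 * θ m ^ (1 - 1 / p) / σ * (netSum G θ p m 1 / σ ^ 3))
        = √((n : ℝ) ^ 2 * θ m ^ (1 - 1 / p) * netSum G θ p m 1) / σ ^ 2 := by
      rw [show (n : ℝ) ^ 2 * θ m ^ (1 - 1 / p) / σ * (netSum G θ p m 1 / σ ^ 3)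
        = (n : ℝ) ^ 2 * θ m ^ (1 - 1 / p) * netSum G θ p m 1 / (σ ^ 2) ^ 2 by field_simp,
        Real.sqrt_div (by positivity), Real.sqrt_sq (by positivity)]
    have e2 : √(4 * covConst K M Θ * (netSum G θ p m 2 / σ ^ 4))
        = √(covConst K M Θ * (4 * netSum G θ p m 2)) / σ ^ 2 := by
      rw [show 4 * covConst K M Θ * (netSum G θ p m 2 / σ ^ 4)
        = covConst K M Θ * (4 * netSum G θ p m 2) / (σ ^ 2) ^ 2 by field_simp,
        Real.sqrt_div (by positivity), Real.sqrt_sq (by positivity)]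
    rw [e1, e2]
    ring

/-- The error in the central limit theorem, in terms of the three quantities that vanish. -/
noncomputable def charFunError (C t a b₁ b₂ : ℝ) : ℝ :=
  C * (a * (1 + |t| * (1 + b₁))) + 6 * t ^ 2 * C * b₁ + |t| * (C * √(a * b₁) + √(4 * C * b₂))

theorem norm_charFun_map_sub_le (h : PsiDependentLaw Q G θ p K M Θ) (hn : 0 < n) (m : ℕ) {σ : ℝ}
    (hσ : 0 < σ) (hvar : σ ^ 2 = variance (fun y : Fin n → ℝ => ∑ i, y i) Q) (t : ℝ) :
    ‖charFun (Q.map fun y => (∑ i, y i) / σ) t - charFun (gaussianReal 0 1) t‖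
      ≤ 2 * |t| * charFunError (covConst K M Θ) t ((n : ℝ) ^ 2 * θ m ^ (1 - 1 / p) / σ)
        (netSum G θ p m 1 / σ ^ 3) (netSum G θ p m 2 / σ ^ 4) := by
  have hmeas : Measurable fun y : Fin n → ℝ => (∑ i, y i) / σ := by fun_prop
  have hC := h.covConst_nonneg
  have ht0 : 0 ≤ θ m ^ (1 - 1 / p) := Real.rpow_nonneg (h.theta_nonneg m) _
  have hn1 := h.netSum_nonneg m 1
  have hn2 := h.netSum_nonneg m 2
  have : IsProbabilityMeasure (Q.map fun y => (∑ i, y i) / σ) :=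
    Measure.isProbabilityMeasure_map hmeas.aemeasurable
  refine norm_charFun_sub_gaussian_le _ ?_ fun u hu c hc => ?_
  · rw [integrable_map_measure (by fun_prop) hmeas.aemeasurable]
    exact (integrable_finsetSum _ fun i _ => h.integrable_eval i).div_const σ
  · rw [integral_map hmeas.aemeasurable (by fun_prop)]
    refine (h.abs_integral_stein_le m hσ hvar u hc).trans ?_
    -- The Lipschitz constant |u|/σ of the cosine need not be bounded, as σ is not assumed bounded
    -- below. For σ < 1, 1 ≤ `netSum` gives 1/σ ≤ `netSum`/σ³.
    have hinv : 1 / σ ≤ 1 + netSum G θ p m 1 / σ ^ 3 := by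
      rcases le_or_gt 1 σ with h1 | h1
      · have : 1 / σ ≤ 1 := by rw [div_le_one hσ]; exact h1
        have : 0 ≤ netSum G θ p m 1 / σ ^ 3 := by positivity
        linarith
      · have hns : 1 ≤ netSum G θ p m 1 :=
          le_trans (by exact_mod_cast hn) (h.le_netSum m)
        have h3 : σ ^ 3 ≤ σ := pow_le_of_le_one hσ.le h1.le (by norm_num)
        have : 1 / σ ≤ netSum G θ p m 1 / σ ^ 3 := by gcongr
        linarith
    have hu2 : u ^ 2 ≤ t ^ 2 := sq_le_sq.2 hu
    unfold charFunError
    gcongr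

end PsiDependentLaw

/-! ### Regular conditional laws of functions of the array -/

section Kernels

variable {α β E F : Type*} {mα : MeasurableSpace α} {mβ : MeasurableSpace β}
  [MeasurableSpace E] [StandardBorelSpace E] [Nonempty E]
  [MeasurableSpace F] [StandardBorelSpace F] [Nonempty F]

/-- The conditional distribution of a function of the conditioning variable and of `Y`. -/
theorem condDistrib_comp_prodMk {μ : Measure α} [IsFiniteMeasure μ] {X : α → β} {Y : α → E}
    (hX : Measurable X) (hY : Measurable Y) {h : β × E → F} (hh : Measurable h) :
    ∀ᵐ a ∂μ, condDistrib (fun a => h (X a, Y a)) X μ (X a)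
      = (condDistrib Y X μ (X a)).map fun y => h (X a, y) := by
  set κ : Kernel β F := (Kernel.id ×ₖ condDistrib Y X μ).map h with hκ
  have hκa : ∀ b, κ b = (condDistrib Y X μ b).map fun y => h (b, y) := by
    intro b
    rw [hκ, Kernel.map_apply _ hh, Kernel.prod_apply, Kernel.id_apply, Measure.dirac_prod,
      Measure.map_map hh (by fun_prop)]
    rfl
  have hfin : IsMarkovKernel κ := Kernel.IsMarkovKernel.map _ hh
  -- The kernel κ disintegrates the joint law, and the disintegration is almost everywhere unique.
  have key : μ.map (fun a => (X a, h (X a, Y a))) = μ.map X ⊗ₘ κ := by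
    have h1 : μ.map (fun a => (X a, h (X a, Y a)))
        = (μ.map fun a => (X a, Y a)).map fun q => (q.1, h q) := by
      rw [Measure.map_map (by fun_prop) (by fun_prop)]
      rfl
    rw [h1, ← compProd_map_condDistrib hY.aemeasurable]
    ext s hs
    have hφ : Measurable fun q : β × E => (q.1, h q) := by fun_prop
    rw [Measure.map_apply hφ hs, Measure.compProd_apply (hφ hs), Measure.compProd_apply hs]
    refine lintegral_congr fun b => ?_
    rw [hκa, Measure.map_apply (by fun_prop) (measurable_prodMk_left hs)]
    rfl
  have := condDistrib_ae_eq_of_measure_eq_compProd X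
    (Y := fun a => h (X a, Y a)) (by fun_prop) key
  filter_upwards [ae_of_ae_map hX.aemeasurable this] with a ha
  rw [ha, hκa]

/-- Applied to the conditional law, this makes σ_n measurable for C_n, so that it can be frozen at ω
in the conditional law of S_n/σ_n. -/
theorem measurable_variance_kernel (κ : Kernel β ℝ) [IsSFiniteKernel κ] :
    Measurable fun b => variance (fun x : ℝ => x) (κ b) := by
  unfold variance evariance
  refine Measurable.ennreal_toReal ?_
  have hmean : Measurable fun b => ∫ x : ℝ, x ∂(κ b) := by
    have : StronglyMeasurable fun q : β × ℝ => q.2 := measurable_snd.stronglyMeasurable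
    exact (this.integral_kernel_prod_right' (κ := κ)).measurable
  refine Measurable.lintegral_kernel_prod_right ?_
  exact (((measurable_snd).sub (hmean.comp measurable_fst)).enorm).pow_const 2

end Kernels

section Conditional

variable {Ω E : Type*} [MeasurableSpace E] [StandardBorelSpace E] [Nonempty E]

/-- The regular conditional distribution of `X` given the sub-σ-algebra `m`. -/
noncomputable def condLawOf (m : MeasurableSpace Ω) {mΩ : MeasurableSpace Ω} (μ : Measure Ω) [IsFiniteMeasure μ]
    (X : Ω → E) : @Kernel Ω E m inferInstance :=
  @condDistrib Ω Ω E _ _ _ mΩ m X id μ _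

variable {m mΩ : MeasurableSpace Ω} {μ : Measure Ω} [IsFiniteMeasure μ] {X : Ω → E}

instance (ω : Ω) : IsProbabilityMeasure (condLawOf m μ X ω) := by
  unfold condLawOf
  infer_instance

instance (X : Ω → ℝ) (ω : Ω) : IsProbabilityMeasure (condLaw m μ X ω) := by
  unfold condLaw
  infer_instance

theorem condLaw_comp_prodMk (hm : m ≤ mΩ) (hX : Measurable X) {h : Ω × E → ℝ}
    (hh : @Measurable _ _ (m.prod inferInstance) _ h) :
    ∀ᵐ ω ∂μ, condLaw m μ (fun ω => h (ω, X ω)) ω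
      = (condLawOf m μ X ω).map fun y => h (ω, y) :=
  @condDistrib_comp_prodMk Ω Ω E ℝ mΩ m _ _ _ _ _ _ μ _ id X (measurable_id'' hm) hX h hh

theorem condLaw_comp (hm : m ≤ mΩ) (hX : Measurable X) {g : E → ℝ} (hg : Measurable g) :
    ∀ᵐ ω ∂μ, condLaw m μ (fun ω => g (X ω)) ω = (condLawOf m μ X ω).map g :=
  condLaw_comp_prodMk hm hX (h := fun q => g q.2) (hg.comp (@measurable_snd Ω E m _))

theorem condExp_comp_eq (hm : m ≤ mΩ) (hX : Measurable X) {g : E → ℝ} (hg : Measurable g)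
    (hint : Integrable (fun ω => g (X ω)) μ) :
    ∀ᵐ ω ∂μ, (μ[fun ω => g (X ω) | m]) ω = ∫ y, g y ∂(condLawOf m μ X ω) := by
  have := @condExp_ae_eq_integral_condDistrib Ω Ω E ℝ _ _ _ _ mΩ μ _ id X m _ _
    (measurable_id'' hm) hX.aemeasurable g hg.stronglyMeasurable hint
  rw [MeasurableSpace.comap_id] at this
  exact this

theorem measurable_condVariance (X : Ω → ℝ) : Measurable[m] fun ω => condVariance m μ X ω := by
  unfold condVariance condLaw
  exact @measurable_variance_kernel Ω m _ inferInstance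

end Conditional

/-! ### Test functions of a row and of its subarrays -/

theorem continuous_of_mem_testFun {n : ℕ} {F : (Fin n → ℝ) → ℝ} (hF : F ∈ testFun n) :
    Continuous F := by
  have hc : ∀ (T : ℝ) (i : Fin n), Continuous fun y : Fin n → ℝ => clip T (y i) :=
    fun T i => (continuous_clip T).comp (continuous_apply i)
  rcases hF with (((⟨q, rfl⟩ | ⟨q, rfl⟩) | ⟨q, rfl⟩) | ⟨q, rfl⟩) | ⟨q, rfl⟩
  · exact hc _ _
  · exact (hc _ _).mul (hc _ _)
  · exact (hc _ _).abs.mul (hc _ _)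
  · fun_prop
  · fun_prop

section Extension

variable {n : ℕ}

/-- Extension by zero of a vector indexed by the positions in `A`. -/
noncomputable def extendZero (A : Finset (Fin n)) (x : Fin A.card → ℝ) : Fin n → ℝ :=
  Function.extend (A.orderEmbOfFin rfl) x 0

theorem extendZero_apply (A : Finset (Fin n)) (x : Fin A.card → ℝ) (l : Fin A.card) :
    extendZero A x (A.orderEmbOfFin rfl l) = x l :=
  (A.orderEmbOfFin rfl).injective.extend_apply x 0 l

theorem sum_eq_sum_orderEmbOfFin (A : Finset (Fin n)) (g : Fin n → ℝ) :
    ∑ i ∈ A, g i = ∑ l, g (A.orderEmbOfFin rfl l) := by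
  conv_lhs => rw [← A.map_orderEmbOfFin_univ rfl, Finset.sum_map]
  rfl

namespace IsBddLipOn

variable {F : (Fin n → ℝ) → ℝ} {A : Finset (Fin n)} {a b : ℝ}

theorem abs_extendZero_sub_le (hF : IsBddLipOn F A a b) (x y : Fin A.card → ℝ) :
    |F (extendZero A x) - F (extendZero A y)| ≤ b * ∑ l, ‖x l - y l‖ := by
  refine (hF.abs_sub_le _ _).trans (le_of_eq ?_)
  rw [sum_eq_sum_orderEmbOfFin]
  simp only [extendZero_apply, Real.norm_eq_abs]

theorem mem_bddLip (hF : IsBddLipOn F A a b) : (fun x => F (extendZero A x)) ∈ BddLip ℝ A.card :=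
  ⟨⟨a, fun _ => hF.abs_le _⟩, ⟨b, hF.abs_extendZero_sub_le⟩⟩

theorem supNorm_le (hF : IsBddLipOn F A a b) : supNorm (fun x => F (extendZero A x)) ≤ a :=
  ciSup_le fun _ => hF.abs_le _

theorem lipConst_le (hF : IsBddLipOn F A a b) : lipConst (fun x => F (extendZero A x)) ≤ b :=
  csInf_le ⟨0, fun _ hK => hK.1⟩ ⟨hF.lip_nonneg, hF.abs_extendZero_sub_le⟩

/-- The two arguments agree on A, so the Lipschitz bound, which sees only A, is 0. -/
theorem extendZero_subArray {Ω : Type*} (hF : IsBddLipOn F A a b) (Y : Fin n → Ω → ℝ) (ω : Ω) :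
    F (extendZero A (subArray Y A rfl ω)) = F fun i => Y i ω := by
  have h := hF.abs_sub_le (extendZero A (subArray Y A rfl ω)) fun i => Y i ω
  rw [sum_eq_sum_orderEmbOfFin] at h
  simp only [extendZero_apply, subArray, sub_self, abs_zero, Finset.sum_const_zero, mul_zero] at h
  exact sub_eq_zero.1 (abs_nonpos_iff.1 h)

end IsBddLipOn

end Extension

theorem supNorm_nonneg {a : ℕ} (f : (Fin a → ℝ) → ℝ) : 0 ≤ supNorm f :=
  Real.iSup_nonneg fun _ => abs_nonneg _

theorem lipConst_nonneg {a : ℕ} (f : (Fin a → ℝ) → ℝ) : 0 ≤ lipConst f :=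
  Real.sInf_nonneg fun _ hK => hK.1

/-! ### Passage from the array to its conditional laws -/

section Array

variable {Ω : Type*} [mΩ : MeasurableSpace Ω] {μ : Measure Ω} [IsProbabilityMeasure μ]
  {C : ℕ → MeasurableSpace Ω} {G : (n : ℕ) → Ω → SimpleGraph (Fin n)}
  {Y : (n : ℕ) → Fin n → Ω → ℝ} {θ : ℕ → ℕ → Ω → ℝ≥0}
  {ψ : (a b : ℕ) → BddLip ℝ a → BddLip ℝ b → ℝ≥0} {K : ℝ}

/-- The regular conditional distribution of the `n`-th row of the array. -/
noncomputable def rowLaw (μ : Measure Ω) [IsProbabilityMeasure μ] (C : ℕ → MeasurableSpace Ω)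
    (Y : (n : ℕ) → Fin n → Ω → ℝ) (n : ℕ) (ω : Ω) : Measure (Fin n → ℝ) :=
  condLawOf (C n) μ (fun ω i => Y n i ω) ω

instance (n : ℕ) (ω : Ω) : IsProbabilityMeasure (rowLaw μ C Y n ω) := by
  unfold rowLaw
  infer_instance

/-- The bound on ψ involves the exact sup-norm and Lipschitz constant, which any admissible a, b,
a', b' dominate. Hence these real parameters can be quantified inside the almost sure statement. -/
theorem ae_abs_cov_rowLaw_le (hC : ∀ n, C n ≤ mΩ) (hY : ∀ n i, Measurable (Y n i))
    (hdep : IsCondPsiDependent μ C G Y θ ψ)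
    (hψ : ∀ a b : ℕ, 0 < a → 0 < b → ∀ (f : BddLip ℝ a) (g : BddLip ℝ b),
      (ψ a b f g : ℝ) ≤ K * ((a : ℝ) * (b : ℝ)) *
        (supNorm f.1 + lipConst f.1) * (supNorm g.1 + lipConst g.1)) (hK : 0 < K) (n : ℕ)
    {F H : (Fin n → ℝ) → ℝ} (hF : Continuous F) (hH : Continuous H)
    {A B : Finset (Fin n)} (hA : A.Nonempty) (hB : B.Nonempty) {s : ℕ} (hs : 0 < s) :
    ∀ᵐ ω ∂μ, ∀ a b a' b' : ℝ, IsBddLipOn F A a b → IsBddLipOn H B a' b' →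
      (∀ i ∈ A, ∀ j ∈ B, (s : ℕ∞) ≤ (G n ω).edist i j) →
      |∫ y, F y * H y ∂(rowLaw μ C Y n ω)
          - (∫ y, F y ∂(rowLaw μ C Y n ω)) * ∫ y, H y ∂(rowLaw μ C Y n ω)|
        ≤ K * ((A.card : ℝ) * B.card) * (a + b) * (a' + b') * (θ n s ω : ℝ) := by
  by_cases hex : (∃ a b, IsBddLipOn F A a b) ∧ ∃ a b, IsBddLipOn H B a b
  swap
  · refine ae_of_all _ fun ω a b a' b' h1 h2 => ?_
    exact absurd ⟨⟨a, b, h1⟩, ⟨a', b', h2⟩⟩ hex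
  obtain ⟨⟨a₀, b₀, hF0⟩, ⟨a₁, b₁, hH0⟩⟩ := hex
  have hYm : Measurable fun ω i => Y n i ω := measurable_pi_lambda _ (hY n)
  have hbd : ∀ {g : (Fin n → ℝ) → ℝ} {M : ℝ}, Continuous g → (∀ y, |g y| ≤ M) →
      ∀ᵐ ω ∂μ, (μ[fun ω => g fun i => Y n i ω | C n]) ω = ∫ y, g y ∂(rowLaw μ C Y n ω) :=
    fun hg hM => condExp_comp_eq (hC n) hYm hg.measurable
      (Integrable.of_bound (hg.measurable.comp hYm).aestronglyMeasurable _
        (ae_of_all _ fun ω => hM _))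
  have e1 := hbd (g := fun y => F y * H y) (hF.mul hH) (M := a₀ * a₁) fun y => by
    rw [abs_mul]
    exact mul_le_mul (hF0.abs_le y) (hH0.abs_le y) (abs_nonneg _)
      ((abs_nonneg _).trans (hF0.abs_le y))
  have e2 := hbd hF hF0.abs_le
  have e3 := hbd hH hH0.abs_le
  have key := hdep.abs_condCov_le n A.card B.card s hA.card_pos hB.card_pos hs A B rfl rfl
    ⟨_, hF0.mem_bddLip⟩ ⟨_, hH0.mem_bddLip⟩
  filter_upwards [e1, e2, e3, key] with ω e1 e2 e3 key a b a' b' hFab hHab hdist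
  have hd : (s : ℕ∞) ≤ setDist (G n ω) A B :=
    le_iInf₂ fun i hi => le_iInf₂ fun j hj => hdist i hi j hj
  have h1 := key hd
  simp only [condCov, hF0.extendZero_subArray, hH0.extendZero_subArray] at h1
  rw [e1, e2, e3] at h1
  refine h1.trans (mul_le_mul_of_nonneg_right ?_ (θ n s ω).coe_nonneg)
  refine (hψ _ _ hA.card_pos hB.card_pos _ _).trans ?_
  have n1 := supNorm_nonneg fun x => F (extendZero A x)
  have n2 := lipConst_nonneg fun x => F (extendZero A x)
  have n3 := supNorm_nonneg fun x => H (extendZero B x)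
  have n4 := lipConst_nonneg fun x => H (extendZero B x)
  have m1 := hFab.supNorm_le
  have m2 := hFab.lipConst_le
  have m3 := hHab.supNorm_le
  have m4 := hHab.lipConst_le
  have p1 : 0 ≤ a := n1.trans m1
  have p2 : 0 ≤ b := n2.trans m2
  dsimp only
  gcongr

theorem ae_psiDependentLaw_rowLaw (hC : ∀ n, C n ≤ mΩ) (hY : ∀ n i, Measurable (Y n i))
    (hdep : IsCondPsiDependent μ C G Y θ ψ)
    (hψ : ∀ a b : ℕ, 0 < a → 0 < b → ∀ (f : BddLip ℝ a) (g : BddLip ℝ b),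
      (ψ a b f g : ℝ) ≤ K * ((a : ℝ) * (b : ℝ)) *
        (supNorm f.1 + lipConst f.1) * (supNorm g.1 + lipConst g.1)) (hK : 0 < K)
    (hθ : ∀ᵐ ω ∂μ, ∃ M : ℝ≥0, ∀ n s : ℕ, 1 ≤ n → 1 ≤ s → θ n s ω ≤ M)
    (hconn : ∀ n, ∀ᵐ ω ∂μ, (G n ω).Preconnected ∨ Tendsto (fun s => θ n s ω) atTop (𝓝 0))
    {p : ℝ} (hp : 4 < p)
    (hmom : ∀ᵐ ω ∂μ, ∃ M : ℝ≥0, ∀ (n : ℕ) (i : Fin n), condNorm (C n) μ p (Y n i) ω ≤ M)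
    (hmean : ∀ n (i : Fin n), ∀ᵐ ω ∂μ, condMean (C n) μ (Y n i) ω = 0) :
    ∀ᵐ ω ∂μ, ∃ M Θ : ℝ, ∀ n, 0 < n →
      PsiDependentLaw (rowLaw μ C Y n ω) (G n ω) (fun s => (θ n s ω : ℝ)) p K M Θ := by
  have hcov : ∀ᵐ ω ∂μ, ∀ n, ∀ F ∈ testFun n, ∀ H ∈ testFun n, ∀ A B : Finset (Fin n),
      A.Nonempty → B.Nonempty → ∀ s : ℕ, 0 < s →
      ∀ a b a' b' : ℝ, IsBddLipOn F A a b → IsBddLipOn H B a' b' →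
      (∀ i ∈ A, ∀ j ∈ B, (s : ℕ∞) ≤ (G n ω).edist i j) →
      |∫ y, F y * H y ∂(rowLaw μ C Y n ω)
          - (∫ y, F y ∂(rowLaw μ C Y n ω)) * ∫ y, H y ∂(rowLaw μ C Y n ω)|
        ≤ K * ((A.card : ℝ) * B.card) * (a + b) * (a' + b') * (θ n s ω : ℝ) := by
    rw [ae_all_iff]
    intro n
    rw [ae_ball_iff (countable_testFun n)]
    intro F hF
    rw [ae_ball_iff (countable_testFun n)]
    intro H hH
    simp only [ae_all_iff]
    intro A B hA hB s hs
    exact ae_abs_cov_rowLaw_le hC hY hdep hψ hK n (continuous_of_mem_testFun hF)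
      (continuous_of_mem_testFun hH) hA hB hs
  have hlaw : ∀ᵐ ω ∂μ, ∀ n (i : Fin n),
      condLaw (C n) μ (Y n i) ω = (rowLaw μ C Y n ω).map fun y => y i := by
    simp only [ae_all_iff]
    exact fun n i => condLaw_comp (hC n) (measurable_pi_lambda _ (hY n)) (measurable_pi_apply i)
  have h0 : ∀ᵐ ω ∂μ, ∀ n, θ n 0 ω = 1 := ae_all_iff.2 hdep.theta_zero
  have hconn' := ae_all_iff.2 hconn
  have hmean' : ∀ᵐ ω ∂μ, ∀ n (i : Fin n), condMean (C n) μ (Y n i) ω = 0 := by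
    simpa only [ae_all_iff] using hmean
  filter_upwards [hcov, hlaw, h0, hconn', hmean', hθ, hmom]
    with ω hcov hlaw h0 hconn hmean ⟨Mθ, hθ⟩ ⟨M, hM⟩
  have hp0 : 0 < p := by linarith
  have hlint : ∀ n (i : Fin n),
      ∫⁻ y, ENNReal.ofReal (|y i| ^ p) ∂(rowLaw μ C Y n ω) ≤ ENNReal.ofReal ((M : ℝ) ^ p) := by
    intro n i
    have h1 := hM n i
    rw [condNorm, hlaw, lintegral_map (by fun_prop) (measurable_pi_apply i), one_div,
      ENNReal.rpow_inv_le_iff hp0] at h1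
    refine h1.trans (le_of_eq ?_)
    rw [← ENNReal.ofReal_rpow_of_nonneg M.coe_nonneg hp0.le, ENNReal.ofReal_coe_nnreal]
  have hmeas : ∀ n (i : Fin n),
      AEStronglyMeasurable (fun y : Fin n → ℝ => |y i| ^ p) (rowLaw μ C Y n ω) :=
    fun n i => (by fun_prop : Measurable fun y : Fin n → ℝ => |y i| ^ p).aestronglyMeasurable
  -- Both constants depend on ω but not on n. The 1 accounts for s = 0, where θ is 1 and `hθ` gives
  -- no bound.
  refine ⟨(M : ℝ) ^ p, max 1 Mθ, fun n hn => ?_⟩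
  exact
  { four_lt := hp
    K_nonneg := hK.le
    one_le_Theta := le_max_left _ _
    integrable_rpow := fun i => by
      refine ⟨hmeas n i, ?_⟩
      rw [hasFiniteIntegral_iff_ofReal (ae_of_all _ fun y => by positivity)]
      exact (hlint n i).trans_lt ENNReal.ofReal_lt_top
    integral_rpow_le := fun i => by
      rw [integral_eq_lintegral_of_nonneg_ae (ae_of_all _ fun y => by positivity) (hmeas n i)]
      exact ENNReal.toReal_le_of_le_ofReal (by positivity) (hlint n i)
    integral_eq_zero := fun i => by
      have h1 := hmean n i
      rw [condMean, hlaw, integral_map (measurable_pi_apply i).aemeasurable (by fun_prop)] at h1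
      exact h1
    theta_nonneg := fun s => (θ n s ω).coe_nonneg
    theta_zero := by simp [h0 n]
    theta_le := fun s => by
      rcases Nat.eq_zero_or_pos s with rfl | hs
      · simp [h0 n]
      · exact le_max_of_le_right (by exact_mod_cast hθ n s hn hs)
    connected_or := (hconn n).imp_right fun h => by
      have := NNReal.tendsto_coe.2 h
      rwa [NNReal.coe_zero] at this
    cov_le := fun F hF H hH A B hA hB a b a' b' h1 h2 s hs hd =>
      hcov n F hF H hH A B hA hB s hs a b a' b' h1 h2 hd }

theorem sigma_eq (hC : ∀ n, C n ≤ mΩ) (hY : ∀ n i, Measurable (Y n i)) :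
    ∀ᵐ ω ∂μ, ∀ n, sigma μ C Y n ω ^ 2 = variance (fun y => ∑ i, y i) (rowLaw μ C Y n ω) := by
  rw [ae_all_iff]
  intro n
  have := condLaw_comp (μ := μ) (hC n) (measurable_pi_lambda _ (hY n))
    (g := fun y : Fin n → ℝ => ∑ i, y i) (by fun_prop)
  filter_upwards [this] with ω hω
  rw [sigma, condVariance, Real.sq_sqrt (variance_nonneg _ _)]
  change variance _ (condLaw (C n) μ (fun ω => ∑ i, Y n i ω) ω) = _
  rw [hω]
  exact variance_id_map (by fun_prop)

theorem measurable_sum_div {n : ℕ} {β : Type*} [MeasurableSpace β] {σ : β → ℝ}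
    (hσ : Measurable σ) : Measurable fun q : β × (Fin n → ℝ) => (∑ i, q.2 i) / σ q.1 := by
  fun_prop

/-- Under the conditional law σ_n is a constant, being C_n-measurable, so the deterministic
estimates apply to S_n/σ_n. -/
theorem condLaw_normalized_eq (hC : ∀ n, C n ≤ mΩ) (hY : ∀ n i, Measurable (Y n i)) :
    ∀ᵐ ω ∂μ, ∀ n, condLaw (C n) μ (fun ω => rowSum Y n ω / sigma μ C Y n ω) ω
      = (rowLaw μ C Y n ω).map fun y => (∑ i, y i) / sigma μ C Y n ω := by
  rw [ae_all_iff]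
  intro n
  have hσ : Measurable[C n] (sigma μ C Y n) :=
    Real.continuous_sqrt.measurable.comp (measurable_condVariance _)
  exact condLaw_comp_prodMk (hC n) (measurable_pi_lambda _ (hY n))
    (@measurable_sum_div n Ω (C n) _ hσ)

end Array

end NetCLT

/-! ### The conditional central limit theorem -/

theorem theorem3p2 {Ω : Type*} [mΩ : MeasurableSpace Ω] (μ : Measure Ω) [IsProbabilityMeasure μ]
    -- the σ-fields, the random networks (adapted to them) and the real triangular array
    (C : ℕ → MeasurableSpace Ω) (hC : ∀ n, C n ≤ mΩ)
    (G : (n : ℕ) → Ω → SimpleGraph (Fin n))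
    (hG : ∀ n (i j : Fin n), MeasurableSet[C n] {ω | (G n ω).Adj i j})
    (Y : (n : ℕ) → Fin n → Ω → ℝ) (hY : ∀ n i, Measurable (Y n i))
    -- conditional ψ-dependence, the bound on ψ, the bound on θ
    (θ : ℕ → ℕ → Ω → ℝ≥0) (ψ : (a b : ℕ) → NetCLT.BddLip ℝ a → NetCLT.BddLip ℝ b → ℝ≥0)
    (hdep : NetCLT.IsCondPsiDependent μ C G Y θ ψ)
    (hψ : ∃ K : ℝ, 0 < K ∧ ∀ a b : ℕ, 0 < a → 0 < b →
      ∀ (f : NetCLT.BddLip ℝ a) (g : NetCLT.BddLip ℝ b),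
        (ψ a b f g : ℝ) ≤ K * ((a : ℝ) * (b : ℝ)) *
          (NetCLT.supNorm f.1 + NetCLT.lipConst f.1) * (NetCLT.supNorm g.1 + NetCLT.lipConst g.1))
    (hθ : ∀ᵐ ω ∂μ, ∃ M : ℝ≥0, ∀ n s : ℕ, 1 ≤ n → 1 ≤ s → θ n s ω ≤ M)
    -- a.s. the network is connected, or else the dependence coefficients vanish at infinity
    (hconn : ∀ n, ∀ᵐ ω ∂μ, (G n ω).Preconnected ∨ Tendsto (fun s => θ n s ω) atTop (𝓝 0))
    -- uniformly bounded conditional moments of an order `p > 4`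
    (p : ℝ) (hp : 4 < p)
    (hmom : ∀ᵐ ω ∂μ, ∃ M : ℝ≥0, ∀ (n : ℕ) (i : Fin n), NetCLT.condNorm (C n) μ p (Y n i) ω ≤ M)
    -- the restriction on the network and the dependence coefficients
    (hσ : ∀ᵐ ω ∂μ, ∀ᶠ n in atTop, 0 < NetCLT.sigma μ C Y n ω)
    (m : ℕ → ℕ) (hmpos : ∀ n, 0 < m n) (hm : Tendsto m atTop atTop)
    (hnet : ∀ k : ℕ, k = 1 ∨ k = 2 → ∀ᵐ ω ∂μ, Tendsto (fun n : ℕ =>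
      (n : ℝ) / NetCLT.sigma μ C Y n ω ^ (2 + k) *
        ∑' s : ℕ, NetCLT.cNet (G n ω) s (m n) (k : ℝ) *
          (θ n s ω : ℝ) ^ (1 - (2 + (k : ℝ)) / p)) atTop (𝓝 0))
    (htail : ∀ᵐ ω ∂μ, Tendsto (fun n : ℕ =>
      (n : ℝ) ^ 2 * (θ n (m n) ω : ℝ) ^ (1 - 1 / p) / NetCLT.sigma μ C Y n ω) atTop (𝓝 0))
    -- conditional centring
    (hmean : ∀ n (i : Fin n), ∀ᵐ ω ∂μ, NetCLT.condMean (C n) μ (Y n i) ω = 0) :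
    ∀ᵐ ω ∂μ, Tendsto (fun n : ℕ =>
      ⨆ t : ℝ, |NetCLT.condCdf (C n) μ
          (fun ω' => NetCLT.rowSum Y n ω' / NetCLT.sigma μ C Y n ω') t ω
        - cdf (gaussianReal 0 1) t|) atTop (𝓝 0) := by
  obtain ⟨K, hK, hψ⟩ := hψ
  filter_upwards [NetCLT.ae_psiDependentLaw_rowLaw hC hY hdep hψ hK hθ hconn hp hmom hmean,
    NetCLT.sigma_eq hC hY, NetCLT.condLaw_normalized_eq hC hY, hσ,
    hnet 1 (Or.inl rfl), hnet 2 (Or.inr rfl), htail]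
    with ω ⟨M, Θ, hlaw⟩ hvar hmap hσ h1 h2 ht
  refine tendsto_iSup_abs_sub_cdf_gaussian _ fun t => ?_
  rw [tendsto_iff_norm_sub_tendsto_zero]
  set cc := NetCLT.PsiDependentLaw.covConst K M Θ
  -- This rebuilds 2|t| `charFunError` from the three vanishing quantities, for fixed ω and t.
  have hlim := ((((ht.mul (((h1.const_add 1).const_mul |t|).const_add 1)).const_mul cc).add
    (h1.const_mul (6 * t ^ 2 * cc))).add
    ((((ht.mul h1).sqrt.const_mul cc).add ((h2.const_mul (4 * cc)).sqrt)).const_mul |t|)).const_mul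
      (2 * |t|)
  simp only [mul_zero, zero_mul, add_zero, Real.sqrt_zero] at hlim
  refine squeeze_zero' (Eventually.of_forall fun n => norm_nonneg _) ?_ hlim
  filter_upwards [hσ, eventually_gt_atTop 0] with n hσn hn
  rw [hmap n]
  refine ((hlaw n hn).norm_charFun_map_sub_le hn (m n) hσn (hvar n) t).trans (le_of_eq ?_)
  have e1 : NetCLT.PsiDependentLaw.netSum (G n ω) (fun s => (θ n s ω : ℝ)) p (m n) 1
      / NetCLT.sigma μ C Y n ω ^ 3 = (n : ℝ) / NetCLT.sigma μ C Y n ω ^ (2 + 1) *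
        ∑' s : ℕ, NetCLT.cNet (G n ω) s (m n) ((1 : ℕ) : ℝ) *
          (θ n s ω : ℝ) ^ (1 - (2 + ((1 : ℕ) : ℝ)) / p) := by
    unfold NetCLT.PsiDependentLaw.netSum
    ring
  have e2 : NetCLT.PsiDependentLaw.netSum (G n ω) (fun s => (θ n s ω : ℝ)) p (m n) 2
      / NetCLT.sigma μ C Y n ω ^ 4 = (n : ℝ) / NetCLT.sigma μ C Y n ω ^ (2 + 2) *
        ∑' s : ℕ, NetCLT.cNet (G n ω) s (m n) ((2 : ℕ) : ℝ) *
          (θ n s ω : ℝ) ^ (1 - (2 + ((2 : ℕ) : ℝ)) / p) := by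
    unfold NetCLT.PsiDependentLaw.netSum
    ring
  rw [e1, e2]
  rfl
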